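/- Let $\mathcal G=(\mathcal V,\mathcal E,W)$ be a connected undirected network with $n\ge 2$ agents, without self-loops, whose adjacency matrix $W=(w_{ij})$ is symmetric with $w_{ij}\ge 0$, and $w_{ij}\neq 0$ iff $(i,j)\in\mathcal E$. The Laplacian $L(W)$ of a (possibly directed) network with adjacency matrix $W$ has entries $l_{ii}=\sum_j w_{ij}$ and $l_{ij}=-w_{ij}$ for $i\ne j$. Let $\boldsymbol v$ be a normalized eigenvector of $L(W)$ for its second smallest eigenvalue, counted with multiplicity (a Fiedler vector; any one, if that eigenvalue is not simple). A node $i$ is called positive, negative or zero according to the sign of $v_i$. A cut node of a graph is a node whose removal leaves a disconnected graph, and a block of $\mathcal G$ is a maximal connected subgraph that has no cut nodes. A core block is a block containing both positive and negative nodes. If there is no core block, a core node is a zero cut node of $\mathcal G$ that has a non-zero neighbor. A block is positive (negative, zero) if all its nodes, with the exception of a core node, are positive (negative, zero). The FSN network $\bar{\mathcal G}$ of $\mathcal G$ is the directed network on $\mathcal V$ with adjacency matrix $\bar W=(\bar w_{ij})$, where: if $i$ and $j$ are adjacent nodes of a common positive or negative block, then $\bar w_{ij}=w_{ij}$ if $v_i/v_j>1$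 or $v_i/v_j<0$, and $\bar w_{ij}=0$ if $0\le v_i/v_j\le 1$ (where the quotient of a non-zero $v_i$ by $v_j=0$, which occurs only if $j$ is a core node, counts as infinite, so that $\bar w_{ij}=w_{ij}$); for all other pairs, $\bar w_{ij}=w_{ij}$. **Theorem.** Let $d\ge 0$. Every solution $\boldsymbol x=(\boldsymbol x_i)_{i\in\mathcal V}$, $\boldsymbol x_i(t)\in\mathbb R^d$, $t\ge 0$, of $\dot{\boldsymbol x}=-(L(\bar W)\otimes I_d)\boldsymbol x$ achieves consensus, that is, $\lim_{t\to\infty}\|\boldsymbol x_i(t)-\boldsymbol x_j(t)\|=0$ for all $i,j\in\mathcal V$. Moreover, one of the following holds: 1. there is exactly one core block $B_0$, and for every solution, every $\boldsymbol x_i(t)$ converges as $t\to\infty$ to the average of the initial states $\boldsymbol x_k(0)$ over all agents $k$ that belong to $B_0$ or to a zero block; 2. there is no core block and there is exactly one core node $c$, and for every solution, every $\boldsymbol x_i(t)$ converges as $t\to\infty$ to the average of the initial states $\boldsymbol x_k(0)$ over $k=c$ and all agents $k$ that belong to a zero block. -/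

import Mathlib

open scoped Topology

/-- The Laplacian of the (possibly directed) weighted network with adjacency matrix `W`:
`l_ii = ∑ j, w_ij`, and `l_ij = -w_ij` for `i ≠ j`. Agent `i` follows agent `j` with weight
`w_ij`. -/
def networkLaplacian {V : Type*} [Fintype V] [DecidableEq V] (W : Matrix V V ℝ) :
    Matrix V V ℝ :=
  Matrix.of fun i j => if i = j then ∑ k, W i k else -W i j

theorem networkLaplacian_isHermitian {V : Type*} [Fintype V] [DecidableEq V]
    {W : Matrix V V ℝ} (hW : W.IsSymm) : (networkLaplacian W).IsHermitian := by
  ext i j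
  by_cases h : i = j
  · subst h
    simp [networkLaplacian]
  · simp [networkLaplacian, h, Ne.symm h, hW.apply i j]

/-- The underlying graph of a network whose adjacency matrix `W` is symmetric: `i` and `j` are
adjacent when `i ≠ j` and `w_ij ≠ 0`. -/
def networkGraph {V : Type*} (W : Matrix V V ℝ) : SimpleGraph V :=
  SimpleGraph.fromRel fun i j => W i j ≠ 0

/-- The second smallest eigenvalue (with multiplicity) of a real symmetric matrix of size at least
two. Mathlib's `eigenvalues₀` lists the eigenvalues in decreasing order, hence `Fin.rev`. -/
noncomputable def secondSmallestEigenvalue {V : Type*} [Fintype V] [DecidableEq V]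
    {M : Matrix V V ℝ} (hM : M.IsHermitian) (hn : 1 < Fintype.card V) : ℝ :=
  hM.eigenvalues₀ (Fin.rev ⟨1, hn⟩)

/-- `v` is a normalized eigenvector of the Laplacian of `W` for the second smallest eigenvalue. -/
def IsFiedlerVector {V : Type*} [Fintype V] [DecidableEq V] (W : Matrix V V ℝ)
    (hW : W.IsSymm) (hn : 1 < Fintype.card V) (v : V → ℝ) : Prop :=
  v ⬝ᵥ v = 1 ∧
    (networkLaplacian W).mulVec v =
      secondSmallestEigenvalue (networkLaplacian_isHermitian hW) hn • v

/-- A cut node of a graph `H`: a node whose removal, with all incident edges, leaves a disconnected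
graph (some two remaining nodes are not joined by a path). -/
def IsCutNode {V : Type*} {G : SimpleGraph V} (H : G.Subgraph) (i : V) : Prop :=
  i ∈ H.verts ∧ ¬ (H.deleteVerts {i}).Preconnected

/-- A block of `G`: a maximal connected subgraph without cut nodes (of its own). -/
def IsBlock {V : Type*} (G : SimpleGraph V) (B : G.Subgraph) : Prop :=
  Maximal (fun H : G.Subgraph => H.Connected ∧ ∀ i, ¬ IsCutNode H i) B

/-- A core block: a block with both positive and negative nodes. -/
def IsCoreBlock {V : Type*} (G : SimpleGraph V) (v : V → ℝ) (B : G.Subgraph) : Prop :=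
  IsBlock G B ∧ (∃ i ∈ B.verts, 0 < v i) ∧ ∃ j ∈ B.verts, v j < 0

/-- A core node: when no block contains both positive and negative nodes, a zero cut node of `G`
with a non-zero neighbor. -/
def IsCoreNode {V : Type*} (G : SimpleGraph V) (v : V → ℝ) (c : V) : Prop :=
  (∀ B, ¬ IsCoreBlock G v B) ∧ IsCutNode (⊤ : G.Subgraph) c ∧ v c = 0 ∧ ∃ j, G.Adj c j ∧ v j ≠ 0

/-- A positive block: all its nodes are positive, with the exception of the core node, if any. -/
def IsPositiveBlock {V : Type*} (G : SimpleGraph V) (v : V → ℝ) (B : G.Subgraph) : Prop :=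
  IsBlock G B ∧ ∀ i ∈ B.verts, 0 < v i ∨ IsCoreNode G v i

/-- A negative block: all its nodes are negative, with the exception of the core node, if any. -/
def IsNegativeBlock {V : Type*} (G : SimpleGraph V) (v : V → ℝ) (B : G.Subgraph) : Prop :=
  IsBlock G B ∧ ∀ i ∈ B.verts, v i < 0 ∨ IsCoreNode G v i

/-- A zero block: all its nodes (the core node, if present, included) are zero nodes. -/
def IsZeroBlock {V : Type*} (G : SimpleGraph V) (v : V → ℝ) (B : G.Subgraph) : Prop :=
  IsBlock G B ∧ ∀ i ∈ B.verts, v i = 0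

/-- The set of all agents that belong to some zero block. -/
def zeroBlockAgents {V : Type*} (G : SimpleGraph V) (v : V → ℝ) : Set V :=
  {i | ∃ B, IsZeroBlock G v B ∧ i ∈ B.verts}

/-- The ratio `v_i / v_j` is `> 1` or `< 0`. A quotient of a non-zero number by `v_j = 0` (which
occurs only when `j` is the core node) counts as infinite, so that it satisfies the condition. -/
def RatioKept {V : Type*} (v : V → ℝ) (i j : V) : Prop :=
  (v j ≠ 0 ∧ (1 < v i / v j ∨ v i / v j < 0)) ∨ (v j = 0 ∧ v i ≠ 0)

open Classical in
/-- The adjacency matrix of the FSN network: between nodes `i`, `j` of a positive or negative block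
the weight `w_ij` is kept exactly when the ratio `v_i / v_j` is `> 1` or `< 0`, and is replaced by
`0` otherwise; all other weights are kept. -/
noncomputable def fsnWeights {V : Type*} (W : Matrix V V ℝ) (v : V → ℝ) : Matrix V V ℝ :=
  Matrix.of fun i j =>
    if ∃ B, (IsPositiveBlock (networkGraph W) v B ∨ IsNegativeBlock (networkGraph W) v B) ∧
        i ∈ B.verts ∧ j ∈ B.verts
    then (if RatioKept v i j then W i j else 0)
    else W i j

/-- `x t i` is the state of agent `i` at time `t`, and `x` solves `ẋ = -(L ⊗ I_d) x` on `[0, ∞)`,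
where `L` is the Laplacian of `W`. This is written for each of the `n` blocks of size `d`. -/
def IsConsensusTrajectory {V : Type*} [Fintype V] [DecidableEq V] (W : Matrix V V ℝ) {d : ℕ}
    (x : ℝ → V → EuclideanSpace ℝ (Fin d)) : Prop :=
  ∀ i, ∀ t : ℝ, 0 ≤ t →
    HasDerivWithinAt (fun s => x s i) (-∑ j, networkLaplacian W i j • x t j) (Set.Ici 0) t

/-- The trajectory achieves consensus: `‖x_i(t) - x_j(t)‖ → 0` for all agents `i`, `j`. -/
def AchievesConsensus {V : Type*} {d : ℕ} (x : ℝ → V → EuclideanSpace ℝ (Fin d)) : Prop :=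
  ∀ i j, Filter.Tendsto (fun t => ‖x t i - x t j‖) Filter.atTop (𝓝 0)

/-- All agents converge to the common value `a`. -/
def HasConsensusValue {V : Type*} {d : ℕ} (x : ℝ → V → EuclideanSpace ℝ (Fin d))
    (a : EuclideanSpace ℝ (Fin d)) : Prop :=
  ∀ i, Filter.Tendsto (fun t => x t i) Filter.atTop (𝓝 a)

open Classical in
/-- The average of the vectors `f i` over the agents `i ∈ S`. -/
noncomputable def agentAverage {V : Type*} [Fintype V] {d : ℕ} (S : Set V)
    (f : V → EuclideanSpace ℝ (Fin d)) : EuclideanSpace ℝ (Fin d) :=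
  (S.toFinset.card : ℝ)⁻¹ • ∑ i ∈ S.toFinset, f i

/-!
# Consensus of the FSN network of a Fiedler vector

The proof has a combinatorial part and a dynamical part.

*Signs of a Fiedler vector.* Let `L v = μ v` with `μ` the second smallest eigenvalue. Only the
variational property of `μ` is used: the Rayleigh quotient is at least `μ` on vectors orthogonal to
the constants, with equality only for eigenvectors (`IsFiedlerPair`). If `v k ≥ 0` and two separate
components of `G - k` both have entries below `v k`, then the shortfalls of `v` below `v k` on these
components combine to a test vector of Rayleigh quotient at most `μ`, and less than `μ` if `v k > 0`
(`IsFiedlerPair.two_sides`). So each node `k` either has a distinguished component of `G - k` outside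
of which `v` stays beyond `v k`, away from zero (`IsFiedlerSide`), or is a zero node all of whose
components have constant sign (`IsCharacteristicNode`). A characteristic node is the unique core
node, and excludes core blocks. Without one, following the distinguished components leads to a block
on which they point to each other, and this is the unique core block
(`IsFiedlerPair.exists_isCoreBlock`). The other blocks then have constant sign, since a node outside
a block hangs on a single node of it (`IsBlock.exists_attachment`).

*Dynamics.* Let `S` consist of the zero blocks together with the core block or the core node. As
entries move away from zero on leaving `S`, its nodes follow no outside node; inside `S` the FSN
network is undirected and connected, so that the states in `S` converge to their initial average
by the Poincaré inequality. Every other node follows some node, and only nodes with a smaller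
`|v i|`; by induction on `|v i|` it obeys a stable linear equation whose input converges to that
average (`tendsto_average_of_root`).
-/

open Matrix

/-! ### The Laplacian as an operator, and its quadratic form -/

theorem networkLaplacian_smul_sum {V : Type*} [Fintype V] [DecidableEq V] {E : Type*}
    [AddCommGroup E] [Module ℝ E] {W : Matrix V V ℝ} (hdiag : ∀ i, W i i = 0) (x : V → E) (i : V) :
    ∑ j, networkLaplacian W i j • x j = ∑ j, W i j • (x i - x j) := by
  have key : ∀ j, networkLaplacian W i j • x j =
      (if i = j then (∑ k, W i k) • x i else 0) - W i j • x j := by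
    intro j
    by_cases h : i = j
    · subst h
      simp [networkLaplacian, hdiag]
    · simp [networkLaplacian, h]
  simp only [key, Finset.sum_sub_distrib, smul_sub, Finset.sum_smul]
  simp

theorem networkLaplacian_mulVec_apply {V : Type*} [Fintype V] [DecidableEq V]
    {W : Matrix V V ℝ} (hdiag : ∀ i, W i i = 0) (f : V → ℝ) (i : V) :
    (networkLaplacian W *ᵥ f) i = ∑ j, W i j * (f i - f j) := by
  simpa [Matrix.mulVec, dotProduct] using networkLaplacian_smul_sum hdiag f i

theorem networkLaplacian_mulVec_const {V : Type*} [Fintype V] [DecidableEq V]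
    {W : Matrix V V ℝ} (hdiag : ∀ i, W i i = 0) (c : ℝ) :
    networkLaplacian W *ᵥ (fun _ => c) = 0 := by
  ext i
  simp [networkLaplacian_mulVec_apply hdiag]

theorem dotProduct_networkLaplacian_comm {V : Type*} [Fintype V] [DecidableEq V]
    {W : Matrix V V ℝ} (hsymm : W.IsSymm) (f g : V → ℝ) :
    f ⬝ᵥ (networkLaplacian W *ᵥ g) = g ⬝ᵥ (networkLaplacian W *ᵥ f) := by
  have h : (networkLaplacian W)ᵀ = networkLaplacian W := by
    have := networkLaplacian_isHermitian hsymm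
    simpa [Matrix.IsHermitian, conjTranspose_eq_transpose_of_trivial] using this
  rw [dotProduct_mulVec, ← mulVec_transpose, h, dotProduct_comm]

theorem sum_networkLaplacian_mulVec {V : Type*} [Fintype V] [DecidableEq V]
    {W : Matrix V V ℝ} (hsymm : W.IsSymm) (hdiag : ∀ i, W i i = 0) (f : V → ℝ) :
    ∑ i, (networkLaplacian W *ᵥ f) i = 0 := by
  have h := dotProduct_networkLaplacian_comm hsymm (fun _ => 1) f
  rw [networkLaplacian_mulVec_const hdiag] at h
  simpa [dotProduct] using h

/-- The Dirichlet form of a symmetric matrix of weights: summing by parts over ordered pairs counts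
every edge twice. -/
theorem two_mul_sum_inner_sub {V : Type*} {E : Type*} [NormedAddCommGroup E]
    [InnerProductSpace ℝ E] (S : Finset V) (U : Matrix V V ℝ)
    (hU : ∀ i ∈ S, ∀ j ∈ S, U i j = U j i) (y : V → E) :
    2 * ∑ i ∈ S, ∑ j ∈ S, U i j * inner ℝ (y i) (y i - y j) =
      ∑ i ∈ S, ∑ j ∈ S, U i j * ‖y i - y j‖ ^ 2 := by
  have hswap : ∑ i ∈ S, ∑ j ∈ S, U i j * inner ℝ (y i) (y i - y j) =
      ∑ i ∈ S, ∑ j ∈ S, U i j * inner ℝ (y j) (y j - y i) := by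
    rw [Finset.sum_comm]
    exact Finset.sum_congr rfl fun i hi => Finset.sum_congr rfl fun j hj => by rw [hU i hi j hj]
  rw [two_mul]
  nth_rewrite 2 [hswap]
  simp only [← Finset.sum_add_distrib]
  refine Finset.sum_congr rfl fun i _ => Finset.sum_congr rfl fun j _ => ?_
  rw [← mul_add, ← real_inner_self_eq_norm_sq]
  congr 1
  simp only [inner_sub_left, inner_sub_right]
  ring

theorem two_mul_dotProduct_networkLaplacian {V : Type*} [Fintype V] [DecidableEq V]
    {W : Matrix V V ℝ} (hsymm : W.IsSymm) (hdiag : ∀ i, W i i = 0) (f : V → ℝ) :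
    2 * (f ⬝ᵥ (networkLaplacian W *ᵥ f)) = ∑ i, ∑ j, W i j * (f i - f j) ^ 2 := by
  have h := two_mul_sum_inner_sub Finset.univ W (fun i _ j _ => hsymm.apply j i) f
  simp only [Real.norm_eq_abs, sq_abs] at h
  rw [← h]
  simp only [dotProduct, networkLaplacian_mulVec_apply hdiag, Finset.mul_sum]
  refine Finset.sum_congr rfl fun i _ => Finset.sum_congr rfl fun j _ => ?_
  simp only [inner, star_trivial, RCLike.re_to_real]
  ring

theorem dotProduct_networkLaplacian_nonneg {V : Type*} [Fintype V] [DecidableEq V]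
    {W : Matrix V V ℝ} (hsymm : W.IsSymm) (hnonneg : ∀ i j, 0 ≤ W i j) (hdiag : ∀ i, W i i = 0)
    (f : V → ℝ) : 0 ≤ f ⬝ᵥ (networkLaplacian W *ᵥ f) := by
  have h := two_mul_dotProduct_networkLaplacian hsymm hdiag f
  have : 0 ≤ ∑ i, ∑ j, W i j * (f i - f j) ^ 2 :=
    Finset.sum_nonneg fun i _ => Finset.sum_nonneg fun j _ =>
      mul_nonneg (hnonneg i j) (sq_nonneg _)
  linarith

theorem networkGraph_adj {V : Type*} {W : Matrix V V ℝ} (hsymm : W.IsSymm)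
    (hdiag : ∀ i, W i i = 0) {i j : V} : (networkGraph W).Adj i j ↔ W i j ≠ 0 := by
  rw [networkGraph, SimpleGraph.fromRel_adj, hsymm.apply i j, or_self]
  refine ⟨fun h => h.2, fun h => ⟨?_, h⟩⟩
  rintro rfl
  exact h (hdiag i)

theorem eq_of_networkLaplacian_mulVec_eq_zero {V : Type*} [Fintype V] [DecidableEq V]
    {W : Matrix V V ℝ} (hsymm : W.IsSymm) (hnonneg : ∀ i j, 0 ≤ W i j) (hdiag : ∀ i, W i i = 0)
    (hconn : (networkGraph W).Connected) {f : V → ℝ} (hf : networkLaplacian W *ᵥ f = 0) (i j : V) :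
    f i = f j := by
  have h := two_mul_dotProduct_networkLaplacian hsymm hdiag f
  rw [hf, dotProduct_zero, mul_zero, eq_comm, Finset.sum_eq_zero_iff_of_nonneg
    (fun i _ => Finset.sum_nonneg fun j _ => mul_nonneg (hnonneg i j) (sq_nonneg _))] at h
  have hadj : ∀ a b, (networkGraph W).Adj a b → f a = f b := by
    intro a b hab
    have h1 := h a (Finset.mem_univ a)
    rw [Finset.sum_eq_zero_iff_of_nonneg
      (fun j _ => mul_nonneg (hnonneg a j) (sq_nonneg _))] at h1
    have h2 := h1 b (Finset.mem_univ b)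
    have h3 := (mul_eq_zero.1 h2).resolve_left ((networkGraph_adj hsymm hdiag).1 hab)
    exact sub_eq_zero.1 (pow_eq_zero_iff two_ne_zero |>.1 h3)
  obtain ⟨p⟩ := hconn.preconnected i j
  induction p with
  | nil => rfl
  | cons hab _ ih => exact (hadj _ _ hab).trans ih

/-! ### The variational characterisation of a Fiedler vector -/

/-- The properties of a connected undirected network `W` and a Fiedler vector `v` of it, with
eigenvalue `μ`, that the combinatorial arguments use. `variational` says that `μ` is a lower bound
of the Rayleigh quotient on the vectors orthogonal to the constants. -/
structure IsFiedlerPair {V : Type*} [Fintype V] [DecidableEq V] (W : Matrix V V ℝ) (v : V → ℝ)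
    (μ : ℝ) : Prop where
  symm : W.IsSymm
  nonneg : ∀ i j, 0 ≤ W i j
  diag : ∀ i, W i i = 0
  conn : (networkGraph W).Connected
  pos : 0 < μ
  eig : networkLaplacian W *ᵥ v = μ • v
  sum_eq_zero : ∑ i, v i = 0
  ne_zero : v ≠ 0
  variational : ∀ f : V → ℝ, ∑ i, f i = 0 → μ * (f ⬝ᵥ f) ≤ f ⬝ᵥ (networkLaplacian W *ᵥ f)

theorem dotProduct_mulVec_eq_sum_eigenvalues {V : Type*} [Fintype V] [DecidableEq V]
    {M : Matrix V V ℝ} (hM : M.IsHermitian) (f : V → ℝ) :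
    f ⬝ᵥ (M *ᵥ f) = ∑ i, hM.eigenvalues i * (f ⬝ᵥ (hM.eigenvectorBasis i).ofLp) ^ 2 := by
  have hT : Mᵀ = M := by simpa [Matrix.IsHermitian, conjTranspose_eq_transpose_of_trivial] using hM
  have h := hM.eigenvectorBasis.sum_inner_mul_inner (WithLp.toLp 2 f) (WithLp.toLp 2 (M *ᵥ f))
  simp only [EuclideanSpace.inner_eq_star_dotProduct, star_trivial] at h
  rw [dotProduct_comm, ← h]
  refine Finset.sum_congr rfl fun i _ => ?_
  have : M *ᵥ f ⬝ᵥ (hM.eigenvectorBasis i).ofLp =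
      hM.eigenvalues i * (f ⬝ᵥ (hM.eigenvectorBasis i).ofLp) := by
    rw [dotProduct_comm, dotProduct_mulVec, ← mulVec_transpose, hT, hM.mulVec_eigenvectorBasis,
      smul_dotProduct, smul_eq_mul, dotProduct_comm f]
  rw [this, dotProduct_comm _ f]
  ring

theorem dotProduct_self_eq_sum_eigenvectorBasis {V : Type*} [Fintype V] [DecidableEq V]
    {M : Matrix V V ℝ} (hM : M.IsHermitian) (f : V → ℝ) :
    f ⬝ᵥ f = ∑ i, (f ⬝ᵥ (hM.eigenvectorBasis i).ofLp) ^ 2 := by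
  have h := hM.eigenvectorBasis.sum_inner_mul_inner (WithLp.toLp 2 f) (WithLp.toLp 2 f)
  simp only [EuclideanSpace.inner_eq_star_dotProduct, star_trivial] at h
  rw [← h]
  refine Finset.sum_congr rfl fun i _ => ?_
  rw [dotProduct_comm _ f]
  ring

/-- In a connected network the eigenvalue `0` is simple and lowest, so that its eigenvectors are the
constants; the other eigenvectors of an orthonormal eigenbasis then span the complement. -/
theorem IsFiedlerVector.isFiedlerPair {V : Type*} [Fintype V] [DecidableEq V] {W : Matrix V V ℝ}
    {hsymm : W.IsSymm} (hnonneg : ∀ i j, 0 ≤ W i j) (hdiag : ∀ i, W i i = 0)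
    (hconn : (networkGraph W).Connected) {hn : 1 < Fintype.card V}
    {v : V → ℝ} (hv : IsFiedlerVector W hsymm hn v) :
    IsFiedlerPair W v (secondSmallestEigenvalue (networkLaplacian_isHermitian hsymm) hn) := by
  set hM := networkLaplacian_isHermitian hsymm
  set μ := secondSmallestEigenvalue hM hn with hμ
  let e : Fin (Fintype.card V) ≃ V := Fintype.equivOfCardEq (Fintype.card_fin _)
  let i0 : V := e (Fin.rev ⟨0, by omega⟩)
  let i1 : V := e (Fin.rev ⟨1, hn⟩)
  have hev : ∀ k, hM.eigenvalues (e k) = hM.eigenvalues₀ k := by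
    intro k
    simp [Matrix.IsHermitian.eigenvalues, e]
  have hi1 : hM.eigenvalues i1 = μ := hev _
  have h01 : i0 ≠ i1 := by
    intro h
    simpa [Fin.ext_iff] using Fin.rev_injective (e.injective h)
  have hmin : ∀ i, hM.eigenvalues i0 ≤ hM.eigenvalues i := by
    intro i
    obtain ⟨k, rfl⟩ := e.surjective i
    rw [hev, hev]
    refine hM.eigenvalues₀_antitone ?_
    rw [Fin.le_iff_val_le_val, Fin.val_rev]
    have := k.2
    simp only
    omega
  have hmin1 : ∀ i, i ≠ i0 → μ ≤ hM.eigenvalues i := by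
    intro i hi
    obtain ⟨k, rfl⟩ := e.surjective i
    rw [← hi1, hev, hev]
    refine hM.eigenvalues₀_antitone ?_
    rw [Fin.le_iff_val_le_val, Fin.val_rev]
    have hk : (k : ℕ) ≠ Fintype.card V - 1 := by
      intro h
      apply hi
      congr 1
      ext
      rw [Fin.val_rev]
      simpa using h
    have := k.2
    simp only
    omega
  have hself : ∀ i, (hM.eigenvectorBasis i).ofLp ⬝ᵥ (hM.eigenvectorBasis i).ofLp = 1 := by
    intro i
    have h := orthonormal_iff_ite.1 hM.eigenvectorBasis.orthonormal i i
    rwa [EuclideanSpace.inner_eq_star_dotProduct, star_trivial, if_pos rfl] at h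
  have horth : (hM.eigenvectorBasis i0).ofLp ⬝ᵥ (hM.eigenvectorBasis i1).ofLp = 0 := by
    have h := orthonormal_iff_ite.1 hM.eigenvectorBasis.orthonormal i1 i0
    rwa [EuclideanSpace.inner_eq_star_dotProduct, star_trivial, if_neg h01.symm] at h
  have hnn : ∀ i, 0 ≤ hM.eigenvalues i := by
    intro i
    have h := dotProduct_networkLaplacian_nonneg hsymm hnonneg hdiag
      (hM.eigenvectorBasis i).ofLp
    rwa [hM.mulVec_eigenvectorBasis, dotProduct_smul, hself, smul_eq_mul, mul_one] at h
  have hzero : hM.eigenvalues i0 = 0 := by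
    -- the constant vector has zero energy, so some coefficient of it sits at the eigenvalue `0`
    refine le_antisymm ?_ (hnn i0)
    have h1 := dotProduct_mulVec_eq_sum_eigenvalues hM (fun _ => 1)
    rw [networkLaplacian_mulVec_const hdiag, dotProduct_zero, eq_comm,
      Finset.sum_eq_zero_iff_of_nonneg (fun i _ => mul_nonneg (hnn i) (sq_nonneg _))] at h1
    by_contra hlt
    push Not at hlt
    have h2 := dotProduct_self_eq_sum_eigenvectorBasis hM (fun _ => 1)
    rw [Finset.sum_eq_zero] at h2
    · simp [dotProduct] at h2
      omega
    · intro i hi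
      exact (mul_eq_zero.1 (h1 i hi)).resolve_left (hlt.trans_le (hmin i)).ne'
  have hker : ∀ i, hM.eigenvalues i = 0 → ∀ a b,
      (hM.eigenvectorBasis i).ofLp a = (hM.eigenvectorBasis i).ofLp b := by
    intro i hi
    apply eq_of_networkLaplacian_mulVec_eq_zero hsymm hnonneg hdiag hconn
    rw [hM.mulVec_eigenvectorBasis, hi, zero_smul]
  have hμpos : 0 < μ := by
    refine lt_of_le_of_ne (hi1 ▸ hnn i1) fun h0 => ?_
    have c0 := hker i0 hzero
    have c1 := hker i1 (hi1.trans h0.symm)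
    have s0 := hself i0
    have s1 := hself i1
    have s01 := horth
    simp only [dotProduct, fun a => c0 a i0, fun a => c1 a i0, Finset.sum_const, nsmul_eq_mul]
      at s0 s1 s01
    have : (((Finset.univ : Finset V).card : ℝ) * ((hM.eigenvectorBasis i0).ofLp i0 *
      (hM.eigenvectorBasis i1).ofLp i0)) ^ 2 = 1 := by
      calc _ = (((Finset.univ : Finset V).card : ℝ) * ((hM.eigenvectorBasis i0).ofLp i0 *
            (hM.eigenvectorBasis i0).ofLp i0)) * (((Finset.univ : Finset V).card : ℝ) *
            ((hM.eigenvectorBasis i1).ofLp i0 * (hM.eigenvectorBasis i1).ofLp i0)) := by ring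
        _ = 1 := by rw [s0, s1, one_mul]
    rw [s01] at this
    norm_num at this
  refine ⟨hsymm, hnonneg, hdiag, hconn, hμpos, hv.2, ?_, ?_, ?_⟩
  · have h := sum_networkLaplacian_mulVec hsymm hdiag v
    rw [hv.2] at h
    simp only [Pi.smul_apply, smul_eq_mul, ← Finset.mul_sum] at h
    exact (mul_eq_zero.1 h).resolve_left hμpos.ne'
  · rintro rfl
    simpa using hv.1
  · intro f hf
    rw [dotProduct_mulVec_eq_sum_eigenvalues hM, dotProduct_self_eq_sum_eigenvectorBasis hM,
      Finset.mul_sum]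
    refine Finset.sum_le_sum fun i _ => ?_
    by_cases hi : i = i0
    · have : f ⬝ᵥ (hM.eigenvectorBasis i).ofLp = 0 := by
        subst hi
        simp only [dotProduct, fun a => hker i0 hzero a i0, ← Finset.sum_mul, hf, zero_mul]
      simp [this]
    · exact mul_le_mul_of_nonneg_right (hmin1 i hi) (sq_nonneg _)

/-- A vector that attains the minimum of the Rayleigh quotient on the complement of the constants
is an eigenvector: otherwise its residual would be a direction of descent. -/
theorem IsFiedlerPair.eigenvector_of_le {V : Type*} [Fintype V] [DecidableEq V]
    {W : Matrix V V ℝ} {v : V → ℝ} {μ : ℝ} (F : IsFiedlerPair W v μ) {h : V → ℝ}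
    (hsum : ∑ i, h i = 0) (hle : h ⬝ᵥ (networkLaplacian W *ᵥ h) ≤ μ * (h ⬝ᵥ h)) :
    networkLaplacian W *ᵥ h = μ • h := by
  set r : V → ℝ := networkLaplacian W *ᵥ h - μ • h with hr
  have hrsum : ∑ i, r i = 0 := by
    simp only [hr, Pi.sub_apply, Pi.smul_apply, smul_eq_mul, Finset.sum_sub_distrib,
      ← Finset.mul_sum, hsum, sum_networkLaplacian_mulVec F.symm F.diag]
    simp
  have hexp : ∀ t : ℝ, 0 ≤ 2 * t * (r ⬝ᵥ r) +
      t ^ 2 * (r ⬝ᵥ (networkLaplacian W *ᵥ r) - μ * (r ⬝ᵥ r)) := by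
    intro t
    have h1 := F.variational (h + t • r) (by
      simp [Finset.sum_add_distrib, ← Finset.mul_sum, hsum, hrsum])
    have h2 : r ⬝ᵥ r = r ⬝ᵥ (networkLaplacian W *ᵥ h) - μ * (r ⬝ᵥ h) := by
      nth_rewrite 2 [hr]
      rw [dotProduct_sub, dotProduct_smul, smul_eq_mul]
    have h3 := dotProduct_networkLaplacian_comm F.symm h r
    simp only [mulVec_add, mulVec_smul, add_dotProduct, dotProduct_add, smul_dotProduct,
      dotProduct_smul, smul_eq_mul, h3, dotProduct_comm h r] at h1
    have h4 : 2 * t * (r ⬝ᵥ r) =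
        2 * t * (r ⬝ᵥ (networkLaplacian W *ᵥ h)) - 2 * t * (μ * (r ⬝ᵥ h)) := by
      rw [h2]
      ring
    linarith
  have hzero : r ⬝ᵥ r = 0 := by
    have hrr : 0 ≤ r ⬝ᵥ r := Finset.sum_nonneg fun i _ => mul_self_nonneg _
    by_contra hne
    have hpos : 0 < r ⬝ᵥ r := lt_of_le_of_ne hrr (Ne.symm hne)
    set A := r ⬝ᵥ (networkLaplacian W *ᵥ r) - μ * (r ⬝ᵥ r)
    have hA : 0 < |A| + 1 := by positivity
    have := hexp (-(r ⬝ᵥ r) / (|A| + 1))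
    have h4 : 2 * (-(r ⬝ᵥ r) / (|A| + 1)) * (r ⬝ᵥ r) + (-(r ⬝ᵥ r) / (|A| + 1)) ^ 2 * A =
        (r ⬝ᵥ r) ^ 2 / (|A| + 1) ^ 2 * (A - 2 * (|A| + 1)) := by
      field_simp
      ring
    rw [h4] at this
    have h5 : A - 2 * (|A| + 1) < 0 := by
      have := le_abs_self A
      have := abs_nonneg A
      linarith
    have h6 : 0 < (r ⬝ᵥ r) ^ 2 / (|A| + 1) ^ 2 := by positivity
    nlinarith
  exact sub_eq_zero.1 (dotProduct_self_eq_zero.1 hzero)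

theorem IsFiedlerPair.neg {V : Type*} [Fintype V] [DecidableEq V]
    {W : Matrix V V ℝ} {v : V → ℝ} {μ : ℝ} (F : IsFiedlerPair W v μ) : IsFiedlerPair W (-v) μ where
  symm := F.symm
  nonneg := F.nonneg
  diag := F.diag
  conn := F.conn
  pos := F.pos
  eig := by rw [mulVec_neg, F.eig, smul_neg]
  sum_eq_zero := by simp [F.sum_eq_zero]
  ne_zero := neg_ne_zero.2 F.ne_zero
  variational := F.variational

/-! ### Linear differential inequalities and stability -/

/-- A stable linear equation forced by a vanishing input has vanishing solutions. -/
theorem tendsto_zero_of_hasDerivWithinAt_forced {E : Type*} [NormedAddCommGroup E] [NormedSpace ℝ E]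
    {y f : ℝ → E} {κ : ℝ} (hκ : 0 < κ)
    (hy : ∀ t : ℝ, 0 ≤ t → HasDerivWithinAt y (-(κ • y t) + f t) (Set.Ici 0) t)
    (hf : Filter.Tendsto f Filter.atTop (𝓝 0)) : Filter.Tendsto y Filter.atTop (𝓝 0) := by
  have hz : ∀ t : ℝ, 0 ≤ t → HasDerivWithinAt (fun s => Real.exp (κ * s) • y s)
      (Real.exp (κ * t) • f t) (Set.Ici 0) t := by
    intro t ht
    have he : HasDerivWithinAt (fun s => Real.exp (κ * s)) (Real.exp (κ * t) * κ) (Set.Ici 0) t :=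
      (((hasDerivAt_id t).const_mul κ).exp.congr_deriv (by simp)).hasDerivWithinAt
    refine (he.smul (hy t ht)).congr_deriv ?_
    rw [smul_add, smul_neg, smul_smul]
    abel
  rw [NormedAddGroup.tendsto_nhds_zero]
  intro ε hε
  have hev : ∀ᶠ t in Filter.atTop, ‖f t‖ < κ * (ε / 2) :=
    NormedAddGroup.tendsto_nhds_zero.1 hf _ (by positivity)
  obtain ⟨T₀, hT₀⟩ := Filter.eventually_atTop.1 hev
  set T := max T₀ 0
  have hT : 0 ≤ T := le_max_right _ _
  set c := ‖Real.exp (κ * T) • y T‖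
  -- compare with the solution `c + (ε / 2) exp (κ t)` of the equation with constant forcing
  have hbound : ∀ t, T ≤ t → ‖y t‖ ≤ Real.exp (-(κ * t)) * c + ε / 2 := by
    intro t ht
    have hB : ∀ s, HasDerivAt (fun s => c + ε / 2 * Real.exp (κ * s))
        (ε / 2 * (Real.exp (κ * s) * κ)) s := fun s =>
      ((((hasDerivAt_id s).const_mul κ).exp.congr_deriv (by simp)).const_mul (ε / 2)).const_add c
    have key := image_norm_le_of_norm_deriv_right_le_deriv_boundary (a := T) (b := t)
      (f := fun s => Real.exp (κ * s) • y s) (f' := fun s => Real.exp (κ * s) • f s)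
      (fun s hs => ((hz s (hT.trans hs.1)).continuousWithinAt).mono
        (fun r hr => hT.trans hr.1))
      (fun s hs => (hz s (hT.trans hs.1)).mono
        (fun r hr => (hT.trans hs.1).trans hr))
      (B := fun s => c + ε / 2 * Real.exp (κ * s))
      (by
        have : 0 ≤ ε / 2 * Real.exp (κ * T) := by positivity
        change c ≤ c + _
        linarith)
      hB
      (by
        intro s hs
        rw [norm_smul, Real.norm_of_nonneg (Real.exp_nonneg _)]
        have := (hT₀ s ((le_max_left _ _).trans hs.1)).le
        have h2 := mul_le_mul_of_nonneg_left this (Real.exp_nonneg (κ * s))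
        linarith)
      ⟨ht, le_rfl⟩
    simp only [norm_smul, Real.norm_of_nonneg (Real.exp_nonneg _)] at key
    have h3 : ‖y t‖ = Real.exp (-(κ * t)) * (Real.exp (κ * t) * ‖y t‖) := by
      rw [← mul_assoc, ← Real.exp_add]
      simp
    have h4 : Real.exp (-(κ * t)) * (c + ε / 2 * Real.exp (κ * t)) =
        Real.exp (-(κ * t)) * c + ε / 2 := by
      have : Real.exp (-(κ * t)) * Real.exp (κ * t) = 1 := by
        rw [← Real.exp_add]
        simp
      linear_combination (ε / 2) * this
    rw [h3, ← h4]
    exact mul_le_mul_of_nonneg_left key (Real.exp_nonneg _)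
  have hlim : Filter.Tendsto (fun t : ℝ => Real.exp (-(κ * t)) * c) Filter.atTop (𝓝 0) := by
    have := (Real.tendsto_exp_neg_atTop_nhds_zero.comp
      (Filter.tendsto_id.const_mul_atTop hκ)).mul_const c
    simpa using! this
  filter_upwards [hlim.eventually (gt_mem_nhds (half_pos hε)), Filter.eventually_ge_atTop T]
    with t h1 h2
  have := hbound t h2
  linarith

/-- Exponential decay of a nonnegative energy that dissipates at a rate proportional to itself. -/
theorem tendsto_zero_of_deriv_le_neg_mul {g g' : ℝ → ℝ} {κ : ℝ} (hκ : 0 < κ) (hg0 : ∀ t, 0 ≤ g t)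
    (hg : ∀ t : ℝ, 0 ≤ t → HasDerivWithinAt g (g' t) (Set.Ici 0) t)
    (hle : ∀ t : ℝ, 0 ≤ t → g' t ≤ -(κ * g t)) : Filter.Tendsto g Filter.atTop (𝓝 0) := by
  have hz : ∀ t : ℝ, 0 ≤ t → HasDerivWithinAt (fun s => Real.exp (κ * s) * g s)
      (Real.exp (κ * t) * κ * g t + Real.exp (κ * t) * g' t) (Set.Ici 0) t := by
    intro t ht
    have he : HasDerivWithinAt (fun s => Real.exp (κ * s)) (Real.exp (κ * t) * κ) (Set.Ici 0) t :=
      (((hasDerivAt_id t).const_mul κ).exp.congr_deriv (by simp)).hasDerivWithinAt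
    exact he.mul (hg t ht)
  have hbound : ∀ t, 0 ≤ t → g t ≤ Real.exp (-(κ * t)) * g 0 := by
    intro t ht
    have key := image_le_of_deriv_right_le_deriv_boundary (a := 0) (b := t)
      (fun s hs => ((hz s hs.1).continuousWithinAt).mono (fun r hr => hr.1))
      (fun s hs => (hz s hs.1).mono (fun r hr => hs.1.trans hr))
      (B := fun _ => g 0) (B' := fun _ => 0) (by simp) continuousOn_const
      (fun s _ => hasDerivWithinAt_const _ _ _)
      (fun s hs => by
        have := mul_le_mul_of_nonneg_left (hle s hs.1) (Real.exp_nonneg (κ * s))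
        linarith)
      ⟨ht, le_rfl⟩
    have h3 : g t = Real.exp (-(κ * t)) * (Real.exp (κ * t) * g t) := by
      rw [← mul_assoc, ← Real.exp_add]
      simp
    rw [h3]
    exact mul_le_mul_of_nonneg_left key (Real.exp_nonneg _)
  have hlim : Filter.Tendsto (fun t : ℝ => Real.exp (-(κ * t)) * g 0) Filter.atTop (𝓝 0) := by
    have := (Real.tendsto_exp_neg_atTop_nhds_zero.comp
      (Filter.tendsto_id.const_mul_atTop hκ)).mul_const (g 0)
    simpa using! this
  refine tendsto_of_tendsto_of_tendsto_of_le_of_le' tendsto_const_nhds hlim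
    (Filter.Eventually.of_forall hg0) ?_
  filter_upwards [Filter.eventually_ge_atTop 0] with t ht using hbound t ht

/-! ### Consensus of a network with a closed undirected root component -/

theorem exists_norm_sub_sq_le_of_reflTransGen {V : Type*} {S : Finset V} {U : Matrix V V ℝ}
    (hnonneg : ∀ i j, 0 ≤ U i j) {i j : V}
    (h : Relation.ReflTransGen (fun a b => a ∈ S ∧ b ∈ S ∧ U a b ≠ 0) i j)
    (E : Type*) [NormedAddCommGroup E] :
    ∃ C : ℝ, 0 ≤ C ∧ ∀ y : V → E,
      ‖y i - y j‖ ^ 2 ≤ C * ∑ a ∈ S, ∑ b ∈ S, U a b * ‖y a - y b‖ ^ 2 := by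
  induction h with
  | refl => exact ⟨0, le_rfl, fun y => by simp⟩
  | @tail b c _ hbc ih =>
    obtain ⟨C, hC, ih⟩ := ih
    obtain ⟨hb, hc, hne⟩ := hbc
    have hpos : 0 < U b c := lt_of_le_of_ne (hnonneg b c) (Ne.symm hne)
    refine ⟨2 * C + 2 / U b c, by positivity, fun y => ?_⟩
    set D := ∑ a ∈ S, ∑ b ∈ S, U a b * ‖y a - y b‖ ^ 2
    have hterm : U b c * ‖y b - y c‖ ^ 2 ≤ D := by
      have h0 : ∀ a b, 0 ≤ U a b * ‖y a - y b‖ ^ 2 := fun a b =>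
        mul_nonneg (hnonneg a b) (sq_nonneg _)
      exact (Finset.single_le_sum (f := fun d => U b d * ‖y b - y d‖ ^ 2)
        (fun d _ => h0 b d) hc).trans
        (Finset.single_le_sum (f := fun a => ∑ d ∈ S, U a d * ‖y a - y d‖ ^ 2)
          (fun a _ => Finset.sum_nonneg fun d _ => h0 a d) hb)
    have h1 : ‖y b - y c‖ ^ 2 ≤ D / U b c := by
      rw [le_div_iff₀ hpos, mul_comm]
      exact hterm
    have h2 : ‖y i - y c‖ ≤ ‖y i - y b‖ + ‖y b - y c‖ := norm_sub_le_norm_sub_add_norm_sub _ _ _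
    have h3 : ‖y i - y c‖ ^ 2 ≤ 2 * ‖y i - y b‖ ^ 2 + 2 * ‖y b - y c‖ ^ 2 := by
      have := pow_le_pow_left₀ (norm_nonneg _) h2 2
      nlinarith [sq_nonneg (‖y i - y b‖ - ‖y b - y c‖)]
    have h4 := ih y
    calc _ ≤ _ := h3
      _ ≤ 2 * (C * D) + 2 * (D / U b c) := by gcongr
      _ = _ := by ring

/-- The Poincaré inequality on a connected set of nodes. -/
theorem exists_sum_norm_sq_le_of_connected {V : Type*} {S : Finset V} (hS : S.Nonempty)
    {U : Matrix V V ℝ} (hnonneg : ∀ i j, 0 ≤ U i j)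
    (hconn : ∀ i ∈ S, ∀ j ∈ S,
      Relation.ReflTransGen (fun a b => a ∈ S ∧ b ∈ S ∧ U a b ≠ 0) i j)
    (E : Type*) [NormedAddCommGroup E] [InnerProductSpace ℝ E] :
    ∃ C : ℝ, 0 < C ∧ ∀ y : V → E, ∑ i ∈ S, y i = 0 →
      ∑ i ∈ S, ‖y i‖ ^ 2 ≤ C * ∑ i ∈ S, ∑ j ∈ S, U i j * ‖y i - y j‖ ^ 2 := by
  have hpair : ∀ i j, ∃ C : ℝ, 0 ≤ C ∧ (i ∈ S → j ∈ S → ∀ y : V → E,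
      ‖y i - y j‖ ^ 2 ≤ C * ∑ a ∈ S, ∑ b ∈ S, U a b * ‖y a - y b‖ ^ 2) := by
    intro i j
    by_cases h : i ∈ S ∧ j ∈ S
    · obtain ⟨C, hC, hy⟩ := exists_norm_sub_sq_le_of_reflTransGen hnonneg (hconn i h.1 j h.2) E
      exact ⟨C, hC, fun _ _ => hy⟩
    · exact ⟨0, le_rfl, fun hi hj => absurd ⟨hi, hj⟩ h⟩
  choose C hC0 hC using hpair
  have hcard : (0 : ℝ) < S.card := by exact_mod_cast hS.card_pos
  have hsum0 : 0 ≤ ∑ i ∈ S, ∑ j ∈ S, C i j :=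
    Finset.sum_nonneg fun i _ => Finset.sum_nonneg fun j _ => hC0 i j
  refine ⟨(∑ i ∈ S, ∑ j ∈ S, C i j + 1) / S.card, by positivity, fun y hy => ?_⟩
  set D := ∑ i ∈ S, ∑ j ∈ S, U i j * ‖y i - y j‖ ^ 2
  have hD : 0 ≤ D := Finset.sum_nonneg fun i _ => Finset.sum_nonneg fun j _ =>
    mul_nonneg (hnonneg i j) (sq_nonneg _)
  -- `2 |S| ∑ ‖y i‖² = ∑ ‖y i - y j‖²` for vectors of sum zero
  have h1 := two_mul_sum_inner_sub S (Matrix.of fun _ _ => 1) (fun _ _ _ _ => rfl) y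
  have h2 : ∀ i ∈ S, ∑ j ∈ S, (Matrix.of fun _ _ => (1 : ℝ)) i j * inner ℝ (y i) (y i - y j) =
      S.card * ‖y i‖ ^ 2 := by
    intro i _
    simp only [Matrix.of_apply, one_mul, ← inner_sum, Finset.sum_sub_distrib, hy, sub_zero,
      Finset.sum_const]
    rw [← Nat.cast_smul_eq_nsmul ℝ, inner_smul_right, real_inner_self_eq_norm_sq]
  rw [Finset.sum_congr rfl h2, ← Finset.mul_sum] at h1
  simp only [Matrix.of_apply, one_mul] at h1
  have h3 : ∑ i ∈ S, ∑ j ∈ S, ‖y i - y j‖ ^ 2 ≤ (∑ i ∈ S, ∑ j ∈ S, C i j) * D := by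
    rw [Finset.sum_mul]
    refine Finset.sum_le_sum fun i hi => ?_
    rw [Finset.sum_mul]
    exact Finset.sum_le_sum fun j hj => hC i j hi hj y
  have h4 : 0 ≤ ∑ i ∈ S, ‖y i‖ ^ 2 := Finset.sum_nonneg fun i _ => sq_nonneg _
  rw [div_mul_eq_mul_div, le_div_iff₀ hcard]
  nlinarith

/-- In a set of nodes that follows no outside node, and whose inner weights are symmetric and
connected, the states converge to their initial average. -/
theorem tendsto_average_of_closed_symmetric {V : Type*} [Fintype V] {E : Type*}
    [NormedAddCommGroup E] [InnerProductSpace ℝ E] {S : Finset V} (hS : S.Nonempty)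
    {U : Matrix V V ℝ} (hnonneg : ∀ i j, 0 ≤ U i j)
    (hclosed : ∀ i ∈ S, ∀ j, j ∉ S → U i j = 0) (hsymm : ∀ i ∈ S, ∀ j ∈ S, U i j = U j i)
    (hconn : ∀ i ∈ S, ∀ j ∈ S,
      Relation.ReflTransGen (fun a b => a ∈ S ∧ b ∈ S ∧ U a b ≠ 0) i j)
    {x : ℝ → V → E}
    (hx : ∀ i, ∀ t : ℝ, 0 ≤ t →
      HasDerivWithinAt (fun s => x s i) (-∑ j, U i j • (x t i - x t j)) (Set.Ici 0) t)
    {i : V} (hi : i ∈ S) :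
    Filter.Tendsto (fun t => x t i) Filter.atTop
      (𝓝 ((S.card : ℝ)⁻¹ • ∑ k ∈ S, x 0 k)) := by
  set a := (S.card : ℝ)⁻¹ • ∑ k ∈ S, x 0 k with ha
  have hcard : (S.card : ℝ) ≠ 0 := by exact_mod_cast hS.card_pos.ne'
  have hrestrict : ∀ i ∈ S, ∀ t, ∑ j, U i j • (x t i - x t j) =
      ∑ j ∈ S, U i j • (x t i - x t j) := by
    intro i hi t
    refine (Finset.sum_subset (Finset.subset_univ S) fun j _ hj => ?_).symm
    rw [hclosed i hi j hj, zero_smul]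
  have hcons : ∀ t : ℝ, 0 ≤ t → ∑ k ∈ S, x t k = ∑ k ∈ S, x 0 k := by
    have hder : ∀ t : ℝ, 0 ≤ t →
        HasDerivWithinAt (fun s => ∑ k ∈ S, x s k) 0 (Set.Ici 0) t := by
      intro t ht
      refine (HasDerivWithinAt.fun_sum fun k _ => hx k t ht).congr_deriv ?_
      rw [Finset.sum_neg_distrib, neg_eq_zero, Finset.sum_congr rfl fun k hk => hrestrict k hk t]
      have hanti : ∑ k ∈ S, ∑ j ∈ S, U k j • (x t k - x t j) =
          -∑ k ∈ S, ∑ j ∈ S, U k j • (x t k - x t j) := by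
        nth_rewrite 1 [Finset.sum_comm]
        rw [← Finset.sum_neg_distrib]
        refine Finset.sum_congr rfl fun k hk => ?_
        rw [← Finset.sum_neg_distrib]
        refine Finset.sum_congr rfl fun j hj => ?_
        rw [hsymm j hj k hk, ← smul_neg, neg_sub]
      have h2 : (2 : ℝ) • ∑ k ∈ S, ∑ j ∈ S, U k j • (x t k - x t j) = 0 := by
        rw [two_smul, ← eq_neg_iff_add_eq_zero]
        exact hanti
      exact (smul_eq_zero.1 h2).resolve_left two_ne_zero
    intro t ht
    exact constant_of_has_deriv_right_zero (a := 0) (b := t)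
      (fun s hs => ((hder s hs.1).continuousWithinAt).mono fun r hr => hr.1)
      (fun s hs => (hder s hs.1).mono fun r hr => hs.1.trans hr) t ⟨ht, le_rfl⟩
  have hsum : ∀ t : ℝ, 0 ≤ t → ∑ k ∈ S, (x t k - a) = 0 := by
    intro t ht
    rw [Finset.sum_sub_distrib, hcons t ht, Finset.sum_const, ← Nat.cast_smul_eq_nsmul ℝ, ha,
      smul_smul, mul_inv_cancel₀ hcard, one_smul, sub_self]
  obtain ⟨C, hC, hpoinc⟩ := exists_sum_norm_sq_le_of_connected hS hnonneg hconn E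
  have hen : Filter.Tendsto (fun t => ∑ k ∈ S, ‖x t k - a‖ ^ 2) Filter.atTop (𝓝 0) := by
    refine tendsto_zero_of_deriv_le_neg_mul (κ := C⁻¹)
      (g' := fun t => -∑ k ∈ S, ∑ j ∈ S, U k j * ‖x t k - x t j‖ ^ 2) (by positivity)
      (fun t => Finset.sum_nonneg fun k _ => sq_nonneg _) ?_ ?_
    · intro t ht
      refine (HasDerivWithinAt.fun_sum fun k _ =>
        ((hx k t ht).sub_const a).norm_sq).congr_deriv ?_
      have h1 := two_mul_sum_inner_sub S U hsymm (fun k => x t k - a)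
      simp only [sub_sub_sub_cancel_right] at h1
      rw [← h1, Finset.mul_sum, ← Finset.sum_neg_distrib]
      refine Finset.sum_congr rfl fun k hk => ?_
      rw [hrestrict k hk, inner_neg_right, inner_sum]
      simp only [inner_smul_right, mul_neg]
    · intro t ht
      have h2 := hpoinc (fun k => x t k - a) (hsum t ht)
      simp only [sub_sub_sub_cancel_right] at h2
      rw [neg_le_neg_iff, inv_mul_le_iff₀ hC]
      exact h2
  have hsq : Filter.Tendsto (fun t => ‖x t i - a‖ ^ 2) Filter.atTop (𝓝 0) :=
    squeeze_zero (fun t => sq_nonneg _)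
      (fun t => Finset.single_le_sum (f := fun k => ‖x t k - a‖ ^ 2)
        (fun k _ => sq_nonneg _) hi) hen
  rw [tendsto_iff_norm_sub_tendsto_zero]
  have := hsq.sqrt
  simpa [Real.sqrt_sq (norm_nonneg _)] using this

/-- Consensus of a directed network with a root component: inside `S` the states converge to their
initial average, and that limit is passed on upwards along the height `h`, as every other node
follows some node and only nodes in `S` or of smaller height. -/
theorem tendsto_average_of_root {V : Type*} [Fintype V] {E : Type*}
    [NormedAddCommGroup E] [InnerProductSpace ℝ E] {S : Finset V} (hS : S.Nonempty)
    {U : Matrix V V ℝ} (hnonneg : ∀ i j, 0 ≤ U i j)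
    (hclosed : ∀ i ∈ S, ∀ j, j ∉ S → U i j = 0) (hsymm : ∀ i ∈ S, ∀ j ∈ S, U i j = U j i)
    (hconn : ∀ i ∈ S, ∀ j ∈ S,
      Relation.ReflTransGen (fun a b => a ∈ S ∧ b ∈ S ∧ U a b ≠ 0) i j)
    (h : V → ℝ) (hfollow : ∀ i, i ∉ S → ∃ j, U i j ≠ 0)
    (hdown : ∀ i, i ∉ S → ∀ j, U i j ≠ 0 → h j < h i)
    {x : ℝ → V → E}
    (hx : ∀ i, ∀ t : ℝ, 0 ≤ t →
      HasDerivWithinAt (fun s => x s i) (-∑ j, U i j • (x t i - x t j)) (Set.Ici 0) t)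
    (i : V) :
    Filter.Tendsto (fun t => x t i) Filter.atTop
      (𝓝 ((S.card : ℝ)⁻¹ • ∑ k ∈ S, x 0 k)) := by
  have hwf : WellFounded fun j i : V => h j < h i :=
    (Finite.wellFounded_of_trans_of_irrefl fun j i : V => h j < h i)
  induction i using hwf.induction with
  | _ i ih =>
  by_cases hi : i ∈ S
  · exact tendsto_average_of_closed_symmetric hS hnonneg hclosed hsymm hconn hx hi
  set a := (S.card : ℝ)⁻¹ • ∑ k ∈ S, x 0 k
  have hpos : 0 < ∑ j, U i j := by
    obtain ⟨j, hj⟩ := hfollow i hi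
    exact Finset.sum_pos' (fun k _ => hnonneg i k)
      ⟨j, Finset.mem_univ j, lt_of_le_of_ne (hnonneg i j) (Ne.symm hj)⟩
  have hlim : Filter.Tendsto (fun t => ∑ j, U i j • (x t j - a)) Filter.atTop (𝓝 0) := by
    rw [← Finset.sum_const_zero (s := (Finset.univ : Finset V))]
    refine tendsto_finsetSum _ fun j _ => ?_
    by_cases hj : U i j = 0
    · simp [hj]
    · have := ((ih j (hdown i hi j hj)).sub_const a).const_smul (U i j)
      simpa using this
  have := tendsto_zero_of_hasDerivWithinAt_forced (y := fun t => x t i - a) hpos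
    (fun t ht => ((hx i t ht).sub_const a).congr_deriv (by
      rw [Finset.sum_smul, ← Finset.sum_neg_distrib, ← Finset.sum_neg_distrib,
        ← Finset.sum_add_distrib]
      refine Finset.sum_congr rfl fun j _ => ?_
      rw [← smul_neg, ← smul_neg, ← smul_add]
      congr 1
      abel)) hlim
  simpa using this.add_const a

/-! ### Blocks of a graph -/

theorem SimpleGraph.Walk.toSubgraph_le_deleteVerts {V : Type*} {G : SimpleGraph V}
    {K : G.Subgraph} {a b i : V} {p : G.Walk a b} (hp : p.toSubgraph ≤ K) (hi : i ∉ p.support) :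
    p.toSubgraph ≤ K.deleteVerts {i} := by
  have hne : ∀ x ∈ p.toSubgraph.verts, x ≠ i := by
    rintro x hx rfl
    exact hi (p.mem_verts_toSubgraph.1 hx)
  refine ⟨fun x hx => ⟨hp.1 hx, hne x hx⟩, fun x y hxy => ?_⟩
  rw [SimpleGraph.Subgraph.deleteVerts_adj]
  exact ⟨hp.1 hxy.fst_mem, hne x hxy.fst_mem, hp.1 hxy.snd_mem, hne y hxy.snd_mem, hp.2 hxy⟩

theorem SimpleGraph.Subgraph.deleteVerts_mono_left {V : Type*} {G : SimpleGraph V}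
    {H K : G.Subgraph} (h : H ≤ K) (s : Set V) : H.deleteVerts s ≤ K.deleteVerts s := by
  refine ⟨fun x hx => ⟨h.1 hx.1, hx.2⟩, fun x y hxy => ?_⟩
  rw [SimpleGraph.Subgraph.deleteVerts_adj] at hxy ⊢
  exact ⟨h.1 hxy.1, hxy.2.1, h.1 hxy.2.2.1, hxy.2.2.2.1, h.2 hxy.2.2.2.2⟩

theorem SimpleGraph.Subgraph.Preconnected.of_le_of_verts_subset {V : Type*} {G : SimpleGraph V}
    {H K : G.Subgraph} (hH : H.Preconnected) (hle : H ≤ K) (hverts : K.verts ⊆ H.verts) :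
    K.Preconnected := by
  rw [SimpleGraph.Subgraph.preconnected_iff_forall_exists_walk_subgraph] at hH ⊢
  intro u w hu hw
  obtain ⟨p, hp⟩ := hH (hverts hu) (hverts hw)
  exact ⟨p, hp.trans hle⟩

/-- A vertex other than `k` is not joined to `k` when the edges at `k` are removed. -/
theorem SimpleGraph.Reachable.ne_of_deleteIncidenceSet {V : Type*} {G : SimpleGraph V} {k x y : V}
    (h : (G.deleteIncidenceSet k).Reachable x y) (hx : x ≠ k) : y ≠ k := by
  obtain ⟨p⟩ := h
  induction p with
  | nil => exact hx
  | cons hab _ ih => exact ih (SimpleGraph.deleteIncidenceSet_adj.1 hab).2.2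

theorem SimpleGraph.Subgraph.Preconnected.reachable_deleteIncidenceSet {V : Type*}
    {G : SimpleGraph V} {H : G.Subgraph} {k : V} (h : (H.deleteVerts {k}).Preconnected) {x y : V}
    (hx : x ∈ H.verts) (hy : y ∈ H.verts) (hxk : x ≠ k) (hyk : y ≠ k) :
    (G.deleteIncidenceSet k).Reachable x y := by
  let f : (H.deleteVerts {k}).coe →g G.deleteIncidenceSet k :=
    { toFun := Subtype.val
      map_rel' := fun {a b} hab => SimpleGraph.deleteIncidenceSet_adj.2
        ⟨(H.deleteVerts {k}).adj_sub hab, a.2.2, b.2.2⟩ }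
  exact (h ⟨x, hx, hxk⟩ ⟨y, hy, hyk⟩).map f

theorem IsBlock.connected {V : Type*} {G : SimpleGraph V} {B : G.Subgraph} (hB : IsBlock G B) :
    B.Connected := hB.prop.1

theorem IsBlock.eq_of_le {V : Type*} {G : SimpleGraph V} {B H : G.Subgraph} (hB : IsBlock G B)
    (hle : B ≤ H) (hH : H.Connected) (hcut : ∀ i, (H.deleteVerts {i}).Preconnected) : B = H :=
  Maximal.eq_of_le hB ⟨hH, fun i hi => hi.2 (hcut i)⟩ hle

theorem IsBlock.deleteVerts_preconnected {V : Type*} {G : SimpleGraph V} {B : G.Subgraph}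
    (hB : IsBlock G B) (i : V) : (B.deleteVerts {i}).Preconnected := by
  by_cases hi : i ∈ B.verts
  · by_contra h
    exact hB.prop.2 i ⟨hi, h⟩
  · rw [SimpleGraph.Subgraph.preconnected_iff_forall_exists_walk_subgraph]
    intro u w hu hw
    obtain ⟨p, hp⟩ := (SimpleGraph.Subgraph.preconnected_iff_forall_exists_walk_subgraph B).1
      hB.connected.preconnected hu.1 hw.1
    exact ⟨p, p.toSubgraph_le_deleteVerts hp fun h => hi (hp.1 (p.mem_verts_toSubgraph.2 h))⟩

theorem IsBlock.reachable_deleteIncidenceSet {V : Type*} {G : SimpleGraph V} {B : G.Subgraph}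
    (hB : IsBlock G B) {k x y : V} (hx : x ∈ B.verts) (hy : y ∈ B.verts) (hxk : x ≠ k)
    (hyk : y ≠ k) : (G.deleteIncidenceSet k).Reachable x y :=
  (hB.deleteVerts_preconnected k).reachable_deleteIncidenceSet hx hy hxk hyk

/-- The union of two blocks with two common nodes has no cut nodes, as one of the common nodes
survives a removal. -/
theorem IsBlock.eq_of_mem_of_mem {V : Type*} {G : SimpleGraph V} {B B' : G.Subgraph}
    (hB : IsBlock G B) (hB' : IsBlock G B') {x y : V} (hxy : x ≠ y) (hx : x ∈ B.verts)
    (hy : y ∈ B.verts) (hx' : x ∈ B'.verts) (hy' : y ∈ B'.verts) : B = B' := by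
  have hconn : (B ⊔ B').Connected :=
    SimpleGraph.Subgraph.connected_sup hB.connected.preconnected hB'.connected.preconnected
      ⟨x, hx, hx'⟩
  have hcut : ∀ i, ((B ⊔ B').deleteVerts {i}).Preconnected := by
    intro i
    have hne : (B.deleteVerts {i} ⊓ B'.deleteVerts {i}).verts.Nonempty := by
      by_cases hxi : x = i
      · exact ⟨y, ⟨hy, fun h => hxy (hxi.trans h.symm)⟩, ⟨hy', fun h => hxy (hxi.trans h.symm)⟩⟩
      · exact ⟨x, ⟨hx, hxi⟩, ⟨hx', hxi⟩⟩
    refine SimpleGraph.Subgraph.Preconnected.of_le_of_verts_subset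
      (SimpleGraph.Subgraph.connected_sup (hB.deleteVerts_preconnected i)
        (hB'.deleteVerts_preconnected i) hne).preconnected
      (sup_le (SimpleGraph.Subgraph.deleteVerts_mono_left le_sup_left _)
        (SimpleGraph.Subgraph.deleteVerts_mono_left le_sup_right _)) ?_
    rintro z ⟨hz | hz, hzi⟩
    · exact Or.inl ⟨hz, hzi⟩
    · exact Or.inr ⟨hz, hzi⟩
  exact (hB.eq_of_le le_sup_left hconn hcut).trans (hB'.eq_of_le le_sup_right hconn hcut).symm

theorem exists_isBlock_of_adj {V : Type*} [Finite V] {G : SimpleGraph V} {a b : V}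
    (hab : G.Adj a b) : ∃ B, IsBlock G B ∧ a ∈ B.verts ∧ b ∈ B.verts := by
  have hP : (G.subgraphOfAdj hab).Connected ∧ ∀ i, ¬ IsCutNode (G.subgraphOfAdj hab) i := by
    refine ⟨SimpleGraph.Subgraph.subgraphOfAdj_connected hab, ?_⟩
    rintro i ⟨hi, hcut⟩
    refine hcut ⟨?_⟩
    have : Subsingleton ((G.subgraphOfAdj hab).deleteVerts {i}).verts := by
      rw [Set.subsingleton_coe]
      rintro x ⟨hx, hxi⟩ y ⟨hy, hyi⟩
      simp only [SimpleGraph.subgraphOfAdj_verts, Set.mem_insert_iff, Set.mem_singleton_iff]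
        at hx hy hi hxi hyi
      grind
    exact SimpleGraph.Preconnected.of_subsingleton
  obtain ⟨B, hle, hB⟩ := Finite.exists_le_maximal
    (p := fun H : G.Subgraph => H.Connected ∧ ∀ i, ¬ IsCutNode H i) hP
  exact ⟨B, hB, hle.1 (by simp), hle.1 (by simp)⟩

theorem IsBlock.exists_ne {V : Type*} [Finite V] [Nontrivial V] {G : SimpleGraph V}
    (hG : G.Connected) {B : G.Subgraph} (hB : IsBlock G B) (x : V) : ∃ y ∈ B.verts, y ≠ x := by
  by_contra! h
  obtain ⟨z, hz⟩ := hB.connected.nonempty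
  obtain rfl := h z hz
  obtain ⟨w, hw⟩ := hG.preconnected.exists_adj_of_nontrivial z
  obtain ⟨B', hB', hz', hw'⟩ := exists_isBlock_of_adj hw
  have hle : B ≤ B' := by
    refine ⟨fun a ha => h a ha ▸ hz', fun a b hab => ?_⟩
    exact absurd ((h a hab.fst_mem).trans (h b hab.snd_mem).symm) hab.ne
  have := hB.eq_of_le hle hB'.connected hB'.deleteVerts_preconnected
  exact hw.ne (h w (this ▸ hw')).symm

/-- A path between two nodes of a block stays in the block: a block with such a path added has no
cut nodes, because from every node of the path one of its two halves leads back to the block and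
avoids the removed node. -/
theorem IsBlock.toSubgraph_le {V : Type*} {G : SimpleGraph V} {B : G.Subgraph} (hB : IsBlock G B)
    {a b : V} (ha : a ∈ B.verts) (hb : b ∈ B.verts) {p : G.Walk a b}
    (hp : p.IsPath) : p.toSubgraph ≤ B := by
  have hconn : (B ⊔ p.toSubgraph).Connected :=
    SimpleGraph.Subgraph.connected_sup hB.connected.preconnected p.toSubgraph_connected.preconnected
      ⟨a, ha, p.start_mem_verts_toSubgraph⟩
  have hcut : ∀ i, ((B ⊔ p.toSubgraph).deleteVerts {i}).Preconnected := by
    intro i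
    rw [SimpleGraph.Subgraph.preconnected_iff_forall_exists_walk_subgraph]
    have hback : ∀ u ∈ ((B ⊔ p.toSubgraph).deleteVerts {i}).verts, ∃ c, c ∈ B.verts ∧ c ≠ i ∧
        ∃ w : G.Walk u c, w.toSubgraph ≤ (B ⊔ p.toSubgraph).deleteVerts {i} := by
      rintro u ⟨hu, hui⟩
      have hui' : u ≠ i := hui
      rcases hu with hu | hu
      · refine ⟨u, hu, hui', SimpleGraph.Walk.nil, ?_⟩
        exact SimpleGraph.Walk.toSubgraph_le_deleteVerts
          ((SimpleGraph.singletonSubgraph_le_iff u _).2 (Or.inl hu)) (by simpa using hui'.symm)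
      · rw [p.mem_verts_toSubgraph, hp.mem_support_iff_exists_append] at hu
        obtain ⟨q, r, -, -, rfl⟩ := hu
        rw [SimpleGraph.Walk.toSubgraph_append]
        by_cases hiq : i ∈ q.support
        · have hir : i ∉ r.support := fun hir =>
            SimpleGraph.Walk.IsPath.ne_of_mem_support_of_append hp hui'.symm hiq hir rfl
          exact ⟨b, hb, fun h => hir (h ▸ r.end_mem_support), r,
            r.toSubgraph_le_deleteVerts (le_sup_right.trans le_sup_right) hir⟩
        · refine ⟨a, ha, fun h => hiq (h ▸ q.start_mem_support), q.reverse, ?_⟩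
          refine SimpleGraph.Walk.toSubgraph_le_deleteVerts ?_ (by simpa using hiq)
          rw [SimpleGraph.Walk.toSubgraph_reverse]
          exact le_sup_left.trans le_sup_right
    intro u w hu hw
    obtain ⟨c, hc, hci, q, hq⟩ := hback u hu
    obtain ⟨c', hc', hci', q', hq'⟩ := hback w hw
    obtain ⟨m, hm⟩ := (SimpleGraph.Subgraph.preconnected_iff_forall_exists_walk_subgraph _).1
      (hB.deleteVerts_preconnected i) ⟨hc, hci⟩ ⟨hc', hci'⟩
    refine ⟨(q.append m).append q'.reverse, ?_⟩
    simp only [SimpleGraph.Walk.toSubgraph_append, SimpleGraph.Walk.toSubgraph_reverse]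
    exact sup_le (sup_le hq (hm.trans
      (SimpleGraph.Subgraph.deleteVerts_mono_left le_sup_left _))) hq'
  rw [hB.eq_of_le le_sup_left hconn hcut]
  exact le_sup_right

/-- A node outside a block hangs on a single node `k` of it: removing `k` separates it from the rest
of the block. -/
theorem IsBlock.exists_attachment {V : Type*} {G : SimpleGraph V} (hG : G.Connected)
    {B : G.Subgraph} (hB : IsBlock G B) {y : V} (hy : y ∉ B.verts) :
    ∃ k ∈ B.verts, ∀ b ∈ B.verts, b ≠ k → ¬ (G.deleteIncidenceSet k).Reachable b y := by
  classical
  obtain ⟨b₀, hb₀⟩ := hB.connected.nonempty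
  have hexit : ∀ y, y ∈ B.verts ∨ ∃ k ∈ B.verts, ∃ z, z ∉ B.verts ∧ G.Adj k z ∧
      (G.deleteIncidenceSet k).Reachable z y := by
    intro y
    obtain ⟨p⟩ := hG.preconnected y b₀
    induction p with
    | nil => exact Or.inl hb₀
    | @cons y y' _ hadj _ ih =>
      by_cases hyB : y ∈ B.verts
      · exact Or.inl hyB
      right
      rcases ih hb₀ with h | ⟨k, hk, z, hz, hkz, hr⟩
      · exact ⟨y', h, y, hyB, hadj.symm, SimpleGraph.Reachable.refl y⟩
      · refine ⟨k, hk, z, hz, hkz, hr.trans (SimpleGraph.Adj.reachable ?_)⟩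
        refine SimpleGraph.deleteIncidenceSet_adj.2
          ⟨hadj.symm, hr.ne_of_deleteIncidenceSet ?_, fun h => hyB (h ▸ hk)⟩
        exact fun h => hz (h ▸ hk)
  obtain ⟨k, hk, z, hz, hkz, hr⟩ := (hexit y).resolve_left hy
  refine ⟨k, hk, fun b hb hbk hby => hz ?_⟩
  obtain ⟨p, hp⟩ := (hr.trans hby.symm).exists_isPath
  have hkp : k ∉ p.support := fun h =>
    (SimpleGraph.Reachable.ne_of_deleteIncidenceSet (k := k) ⟨p.takeUntil k h⟩ hkz.ne') rfl
  have hle : G.deleteIncidenceSet k ≤ G := fun _ _ h => (SimpleGraph.deleteIncidenceSet_adj.1 h).1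
  have hpath : (SimpleGraph.Walk.cons hkz (p.mapLe hle)).IsPath := by
    rw [SimpleGraph.Walk.cons_isPath_iff]
    exact ⟨hp.mapLe hle, by simpa using hkp⟩
  have := hB.toSubgraph_le hk hb hpath
  exact this.1 (by simp)

/-! ### Sign structure of a Fiedler vector at a node -/

/-- The shortfall of `v` below the level `v k` on the set `C`, extended by zero. -/
noncomputable def shortfall {V : Type*} (v : V → ℝ) (k : V) (C : Set V) : V → ℝ :=
  C.indicator fun i => max (v k - v i) 0

theorem shortfall_nonneg {V : Type*} (v : V → ℝ) (k : V) (C : Set V) (i : V) :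
    0 ≤ shortfall v k C i :=
  Set.indicator_nonneg (fun _ _ => le_max_right _ _) i

theorem shortfall_of_notMem {V : Type*} {v : V → ℝ} {k : V} {C : Set V} {i : V} (hi : i ∉ C) :
    shortfall v k C i = 0 := Set.indicator_of_notMem hi _

theorem shortfall_of_mem {V : Type*} {v : V → ℝ} {k : V} {C : Set V} {i : V} (hi : i ∈ C) :
    shortfall v k C i = max (v k - v i) 0 := Set.indicator_of_mem hi _

theorem mem_of_shortfall_pos {V : Type*} {v : V → ℝ} {k : V} {C : Set V} {i : V}
    (hi : 0 < shortfall v k C i) : i ∈ C :=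
  Set.mem_of_indicator_ne_zero hi.ne'

theorem shortfall_pos_of_lt {V : Type*} {v : V → ℝ} {k : V} {C : Set V} {i : V} (hi : i ∈ C)
    (hlt : v i < v k) : 0 < shortfall v k C i := by
  rw [shortfall_of_mem hi]
  exact lt_max_of_lt_left (sub_pos.2 hlt)

section

variable {V : Type*} [Fintype V] [DecidableEq V] {W : Matrix V V ℝ} {v : V → ℝ} {μ : ℝ}

theorem IsFiedlerPair.sum_mul_sub (F : IsFiedlerPair W v μ) (i : V) :
    ∑ j, W i j * (v i - v j) = μ * v i := by
  rw [← networkLaplacian_mulVec_apply F.diag, F.eig]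
  rfl

theorem IsFiedlerPair.adj (F : IsFiedlerPair W v μ) {i j : V} :
    (networkGraph W).Adj i j ↔ W i j ≠ 0 := networkGraph_adj F.symm F.diag

/-- Truncation does not increase the Rayleigh quotient: where it is positive, the shortfall
satisfies the eigenvalue inequality, with a gain of `μ * v k`. -/
theorem IsFiedlerPair.laplacian_shortfall_le (F : IsFiedlerPair W v μ) {k : V} {C : Set V}
    (hC : ∀ i ∈ C, ∀ j, W i j ≠ 0 → j ∈ C ∨ j = k) (hk : k ∉ C) {i : V}
    (hi : 0 < shortfall v k C i) :
    (networkLaplacian W *ᵥ shortfall v k C) i ≤ μ * (shortfall v k C i - v k) := by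
  have hiC := mem_of_shortfall_pos hi
  have hval : shortfall v k C i = v k - v i := by
    rw [shortfall_of_mem hiC] at hi ⊢
    rcases max_choice (v k - v i) 0 with h | h
    · exact h
    · rw [h] at hi
      exact absurd hi (lt_irrefl _)
  have h1 : (networkLaplacian W *ᵥ shortfall v k C) i ≤ ∑ j, W i j * -(v i - v j) := by
    rw [networkLaplacian_mulVec_apply F.diag]
    refine Finset.sum_le_sum fun j _ => ?_
    by_cases hW : W i j = 0
    · simp [hW]
    refine mul_le_mul_of_nonneg_left ?_ (F.nonneg i j)
    rcases hC i hiC j hW with hj | rfl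
    · have := le_max_left (v k - v j) 0
      rw [hval, shortfall_of_mem hj]
      linarith
    · rw [hval, shortfall_of_notMem hk]
      linarith
  refine h1.trans (le_of_eq ?_)
  simp only [mul_neg, Finset.sum_neg_distrib, F.sum_mul_sub i, hval]
  ring

/-- Two separated sides of a node `k` with `v k ≥ 0` cannot both go below the level `v k`, unless
`v k = 0` and negativity spreads over each of them. The test vector is the combination of the two
shortfalls that is orthogonal to the constants: its Rayleigh quotient is at most `μ`, and less than
`μ` if `v k > 0`. -/
theorem IsFiedlerPair.two_sides (F : IsFiedlerPair W v μ) {k : V} (hk : 0 ≤ v k) {C C' : Set V}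
    (hkC : k ∉ C) (hkC' : k ∉ C') (hC : ∀ i ∈ C, ∀ j, W i j ≠ 0 → j ∈ C ∨ j = k)
    (hC' : ∀ i ∈ C', ∀ j, W i j ≠ 0 → j ∈ C' ∨ j = k) (hdisj : Disjoint C C') {x y : V}
    (hx : x ∈ C) (hxk : v x < v k) (hy : y ∈ C') (hyk : v y < v k) :
    v k = 0 ∧ ∀ i ∈ C, v i < 0 → ∀ j ∈ C, W i j ≠ 0 → v j < 0 := by
  set f := shortfall v k C with hf
  set g := shortfall v k C' with hg
  set a := ∑ i, f i with ha
  set b := ∑ i, g i with hb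
  have hf0 : ∀ i, 0 ≤ f i := shortfall_nonneg v k C
  have hg0 : ∀ i, 0 ≤ g i := shortfall_nonneg v k C'
  have hapos : 0 < a := Finset.sum_pos' (fun i _ => hf0 i)
    ⟨x, Finset.mem_univ x, shortfall_pos_of_lt hx hxk⟩
  have hbpos : 0 < b := Finset.sum_pos' (fun i _ => hg0 i)
    ⟨y, Finset.mem_univ y, shortfall_pos_of_lt hy hyk⟩
  set h : V → ℝ := b • f - a • g with hh
  have happ : ∀ i, h i = b * f i - a * g i := fun i => rfl
  have hsum : ∑ i, h i = 0 := by
    simp only [happ, Finset.sum_sub_distrib, ← Finset.mul_sum]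
    rw [← ha, ← hb]
    ring
  have hgC : ∀ i ∈ C, g i = 0 := fun i hi =>
    shortfall_of_notMem (Set.disjoint_left.1 hdisj hi)
  have hfC' : ∀ i ∈ C', f i = 0 := fun i hi =>
    shortfall_of_notMem (Set.disjoint_right.1 hdisj hi)
  have hLg : ∀ i ∈ C, (networkLaplacian W *ᵥ g) i = 0 := by
    intro i hi
    rw [networkLaplacian_mulVec_apply F.diag]
    refine Finset.sum_eq_zero fun j _ => ?_
    by_cases hW : W i j = 0
    · rw [hW, zero_mul]
    rcases hC i hi j hW with hj | rfl
    · rw [hgC i hi, hgC j hj, sub_zero, mul_zero]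
    · rw [hgC i hi, hg, shortfall_of_notMem hkC', sub_zero, mul_zero]
  have hLf : ∀ i ∈ C', (networkLaplacian W *ᵥ f) i = 0 := by
    intro i hi
    rw [networkLaplacian_mulVec_apply F.diag]
    refine Finset.sum_eq_zero fun j _ => ?_
    by_cases hW : W i j = 0
    · rw [hW, zero_mul]
    rcases hC' i hi j hW with hj | rfl
    · rw [hfC' i hi, hfC' j hj, sub_zero, mul_zero]
    · rw [hfC' i hi, hf, shortfall_of_notMem hkC, sub_zero, mul_zero]
  have hLh : networkLaplacian W *ᵥ h =
      b • (networkLaplacian W *ᵥ f) - a • (networkLaplacian W *ᵥ g) := by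
    rw [hh, mulVec_sub, mulVec_smul, mulVec_smul]
  have hpt : ∀ i, h i * (networkLaplacian W *ᵥ h) i ≤
      μ * (h i * h i) - μ * v k * (b ^ 2 * f i + a ^ 2 * g i) := by
    intro i
    rw [hLh, happ, Pi.sub_apply, Pi.smul_apply, Pi.smul_apply, smul_eq_mul, smul_eq_mul]
    rcases (hf0 i).lt_or_eq with hfi | hfi
    · have hiC := mem_of_shortfall_pos hfi
      have h1 := F.laplacian_shortfall_le hC hkC hfi
      rw [hgC i hiC, hLg i hiC]
      have h2 := mul_le_mul_of_nonneg_left h1 (by positivity : 0 ≤ b ^ 2 * f i)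
      linarith
    · rcases (hg0 i).lt_or_eq with hgi | hgi
      · have hiC := mem_of_shortfall_pos hgi
        have h1 := F.laplacian_shortfall_le hC' hkC' hgi
        rw [hfC' i hiC, hLf i hiC]
        have h2 := mul_le_mul_of_nonneg_left h1 (by positivity : 0 ≤ a ^ 2 * g i)
        linarith
      · rw [← hfi, ← hgi]
        simp
  have hq : h ⬝ᵥ (networkLaplacian W *ᵥ h) ≤
      μ * (h ⬝ᵥ h) - μ * v k * (b ^ 2 * a + a ^ 2 * b) := by
    have h1 := Finset.sum_le_sum fun i (_ : i ∈ (Finset.univ : Finset V)) => hpt i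
    rw [Finset.sum_sub_distrib, ← Finset.mul_sum, ← Finset.mul_sum, Finset.sum_add_distrib,
      ← Finset.mul_sum, ← Finset.mul_sum] at h1
    exact h1
  have hvar := F.variational h hsum
  have hk0 : v k = 0 := by
    by_contra hne
    have h1 : 0 < v k := lt_of_le_of_ne hk (Ne.symm hne)
    have h2 : 0 < μ * v k * (b ^ 2 * a + a ^ 2 * b) := by
      have := F.pos
      positivity
    linarith
  refine ⟨hk0, fun i hi hvi j hj hW => ?_⟩
  rw [hk0, mul_zero, zero_mul, sub_zero] at hq
  have heig := F.eigenvector_of_le hsum hq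
  by_contra hvj
  have hfj : f j = 0 := by
    rw [hf, shortfall_of_mem hj, hk0]
    exact max_eq_right (by linarith)
  have hhj : h j = 0 := by rw [happ, hfj, hgC j hj, mul_zero, mul_zero, sub_zero]
  have hzero := congrFun heig j
  rw [networkLaplacian_mulVec_apply F.diag, Pi.smul_apply, hhj, smul_zero] at hzero
  have hWji : W j i ≠ 0 := by rwa [F.symm.apply]
  have hterm : ∀ l ∈ (Finset.univ : Finset V), W j l * (0 - h l) ≤ 0 := by
    intro l _
    by_cases hWl : W j l = 0
    · rw [hWl, zero_mul]
    have hgl : g l = 0 := by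
      rcases hC j hj l hWl with hl | rfl
      · exact hgC l hl
      · exact shortfall_of_notMem hkC'
    have : 0 ≤ h l := by
      rw [happ, hgl, mul_zero, sub_zero]
      exact mul_nonneg hbpos.le (hf0 l)
    exact mul_nonpos_of_nonneg_of_nonpos (F.nonneg j l) (by linarith)
  have h1 := (Finset.sum_eq_zero_iff_of_nonpos hterm).1 hzero i (Finset.mem_univ i)
  have h2 := (mul_eq_zero.1 h1).resolve_left hWji
  have hfi : 0 < f i := shortfall_pos_of_lt hi (by rwa [hk0])
  rw [happ, hgC i hi, mul_zero, sub_zero] at h2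
  have : 0 < b * f i := mul_pos hbpos hfi
  linarith

theorem IsFiedlerPair.component_closed (F : IsFiedlerPair W v μ) {k x : V} :
    ∀ i ∈ {z | ((networkGraph W).deleteIncidenceSet k).Reachable x z ∧ z ≠ k}, ∀ j, W i j ≠ 0 →
      j ∈ {z | ((networkGraph W).deleteIncidenceSet k).Reachable x z ∧ z ≠ k} ∨ j = k := by
  rintro i ⟨hi, hik⟩ j hW
  by_cases hjk : j = k
  · exact Or.inr hjk
  · exact Or.inl ⟨hi.trans (SimpleGraph.Adj.reachable
      (SimpleGraph.deleteIncidenceSet_adj.2 ⟨F.adj.2 hW, hik, hjk⟩)), hjk⟩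

theorem IsFiedlerPair.two_components (F : IsFiedlerPair W v μ) {k x y : V} (hk : 0 ≤ v k)
    (hxk : v x < v k) (hyk : v y < v k)
    (hxy : ¬ ((networkGraph W).deleteIncidenceSet k).Reachable x y) :
    v k = 0 ∧ ∀ z, ((networkGraph W).deleteIncidenceSet k).Reachable x z → v z < 0 := by
  have hx : x ≠ k := by rintro rfl; exact lt_irrefl _ hxk
  have hy : y ≠ k := by rintro rfl; exact lt_irrefl _ hyk
  obtain ⟨h0, hspread⟩ := F.two_sides hk (fun h => h.2 rfl) (fun h => h.2 rfl)
    (F.component_closed (k := k) (x := x)) (F.component_closed (k := k) (x := y))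
    (Set.disjoint_left.2 fun z hz hz' => hxy (hz.1.trans hz'.1.symm))
    ⟨SimpleGraph.Reachable.refl x, hx⟩ hxk ⟨SimpleGraph.Reachable.refl y, hy⟩ hyk
  refine ⟨h0, fun z hz => ?_⟩
  rw [SimpleGraph.reachable_iff_reflTransGen] at hz
  induction hz with
  | refl => rwa [h0] at hxk
  | @tail b c hb hbc ih =>
    rw [← SimpleGraph.reachable_iff_reflTransGen] at hb
    have hadj := SimpleGraph.deleteIncidenceSet_adj.1 hbc
    exact hspread b ⟨hb, hadj.2.1⟩ ih c ⟨hb.trans hbc.reachable, hadj.2.2⟩ (F.adj.1 hadj.1)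

/-- A minimum principle: on a component that hangs on a zero node, a Fiedler vector without negative
entries vanishes identically or nowhere. -/
theorem IsFiedlerPair.pos_of_nonneg (F : IsFiedlerPair W v μ) {k x : V} (hk : v k = 0)
    (hnn : ∀ z, ((networkGraph W).deleteIncidenceSet k).Reachable x z → 0 ≤ v z) (hx : 0 < v x)
    {z : V} (hz : ((networkGraph W).deleteIncidenceSet k).Reachable x z) : 0 < v z := by
  rw [SimpleGraph.reachable_iff_reflTransGen] at hz
  induction hz with
  | refl => exact hx
  | @tail b c hb hbc ih =>
    rw [← SimpleGraph.reachable_iff_reflTransGen] at hb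
    have hadj := SimpleGraph.deleteIncidenceSet_adj.1 hbc
    have hc := hb.trans hbc.reachable
    refine lt_of_le_of_ne (hnn c hc) fun h0 => ?_
    have hsum := F.sum_mul_sub c
    rw [← h0, mul_zero] at hsum
    have hterm : ∀ l ∈ (Finset.univ : Finset V), W c l * (0 - v l) ≤ 0 := by
      intro l _
      by_cases hWl : W c l = 0
      · rw [hWl, zero_mul]
      have : 0 ≤ v l := by
        by_cases hlk : l = k
        · rw [hlk, hk]
        · exact hnn l (hc.trans (SimpleGraph.Adj.reachable
            (SimpleGraph.deleteIncidenceSet_adj.2 ⟨F.adj.2 hWl, hadj.2.2, hlk⟩)))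
      exact mul_nonpos_of_nonneg_of_nonpos (F.nonneg c l) (by linarith)
    have h1 := (Finset.sum_eq_zero_iff_of_nonpos hterm).1 hsum b (Finset.mem_univ b)
    have h2 := (mul_eq_zero.1 h1).resolve_left (F.adj.1 hadj.1.symm)
    linarith

theorem IsFiedlerPair.exists_pos (F : IsFiedlerPair W v μ) : ∃ i, 0 < v i := by
  by_contra! h
  refine F.ne_zero (funext fun i => ?_)
  exact (Finset.sum_eq_zero_iff_of_nonpos fun i _ => h i).1 F.sum_eq_zero i (Finset.mem_univ i)

theorem IsFiedlerPair.exists_neg (F : IsFiedlerPair W v μ) : ∃ i, v i < 0 := by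
  obtain ⟨i, hi⟩ := F.neg.exists_pos
  exact ⟨i, by simpa using hi⟩

end

/-- The component of `G - k` that contains `x` carries all the sign changes of `v`: on the other
components `v` lies beyond `v k`, away from zero, and is zero if `v k = 0`. -/
def IsFiedlerSide {V : Type*} (G : SimpleGraph V) (v : V → ℝ) (k x : V) : Prop :=
  x ≠ k ∧ ∀ z, z ≠ k → ¬ (G.deleteIncidenceSet k).Reachable x z →
    (0 < v k → v k ≤ v z) ∧ (v k < 0 → v z ≤ v k) ∧ (v k = 0 → v z = 0)

/-- A characteristic node: a zero node whose removal leaves components of constant sign. -/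
def IsCharacteristicNode {V : Type*} (G : SimpleGraph V) (v : V → ℝ) (c : V) : Prop :=
  v c = 0 ∧ ∀ x y, x ≠ c → (G.deleteIncidenceSet c).Reachable x y →
    SignType.sign (v x) = SignType.sign (v y)

theorem IsFiedlerSide.congr {V : Type*} {G : SimpleGraph V} {v : V → ℝ} {k x y : V}
    (h : IsFiedlerSide G v k x) (hxy : (G.deleteIncidenceSet k).Reachable x y) :
    IsFiedlerSide G v k y :=
  ⟨hxy.ne_of_deleteIncidenceSet h.1, fun z hz hyz => h.2 z hz fun hxz => hyz (hxy.symm.trans hxz)⟩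

theorem isFiedlerSide_neg {V : Type*} {G : SimpleGraph V} {v : V → ℝ} {k x : V}
    (h : IsFiedlerSide G (-v) k x) : IsFiedlerSide G v k x := by
  refine ⟨h.1, fun z hz hxz => ?_⟩
  obtain ⟨h1, h2, h3⟩ := h.2 z hz hxz
  simp only [Pi.neg_apply, Left.neg_pos_iff, Left.neg_neg_iff, neg_le_neg_iff, neg_eq_zero]
    at h1 h2 h3
  exact ⟨h2, h1, h3⟩

section

variable {V : Type*} [Fintype V] [DecidableEq V] {W : Matrix V V ℝ} {v : V → ℝ} {μ : ℝ}

theorem IsFiedlerPair.isFiedlerSide_of_pos (F : IsFiedlerPair W v μ) {k x : V} (hk : 0 < v k)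
    (hx : v x < v k) : IsFiedlerSide (networkGraph W) v k x := by
  refine ⟨fun h => hx.ne (h ▸ rfl), fun z _ hxz => ⟨fun _ => ?_, fun h => ?_, fun h => ?_⟩⟩
  · by_contra hlt
    push Not at hlt
    exact hk.ne' (F.two_components hk.le hx hlt hxz).1
  · linarith
  · linarith

theorem IsFiedlerPair.isFiedlerSide_of_zero (F : IsFiedlerPair W v μ) {k p n : V} (hk : v k = 0)
    (hp : 0 < v p) (hn : v n < 0) (hpn : ((networkGraph W).deleteIncidenceSet k).Reachable p n) :
    IsFiedlerSide (networkGraph W) v k p := by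
  refine ⟨fun h => hp.ne' (h ▸ hk), fun z _ hpz => ⟨fun h => ?_, fun h => ?_, fun _ => ?_⟩⟩
  · linarith
  · linarith
  · rcases lt_trichotomy (v z) 0 with hz | hz | hz
    · have := (F.two_components hk.ge (x := n) (y := z) (by rwa [hk]) (by rwa [hk])
        fun h => hpz (hpn.trans h)).2 p hpn.symm
      linarith
    · exact hz
    · have := (F.neg.two_components (k := k) (x := p) (y := z) (by simp [hk]) (by simpa [hk])
        (by simpa [hk]) hpz).2 n hpn
      simp only [Pi.neg_apply, Left.neg_neg_iff] at this
      linarith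

theorem IsFiedlerPair.exists_pos_of_neg (F : IsFiedlerPair W v μ) {k x y : V} (hk : v k = 0)
    (hx : v x < 0) (hxy : ((networkGraph W).deleteIncidenceSet k).Reachable x y) (hy : ¬ v y < 0) :
    ∃ p, 0 < v p ∧ ((networkGraph W).deleteIncidenceSet k).Reachable p x := by
  by_contra! h
  refine hy ?_
  have := F.neg.pos_of_nonneg (k := k) (x := x) (by simp [hk])
    (fun z hz => by
      have : ¬ 0 < v z := fun h0 => h z h0 hz.symm
      simpa using this) (by simpa) hxy
  simpa using this

/-- Every node is characteristic, or has a distinguished side. -/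
theorem IsFiedlerPair.isCharacteristicNode_or (F : IsFiedlerPair W v μ) (k : V) :
    IsCharacteristicNode (networkGraph W) v k ∨ ∃ x, IsFiedlerSide (networkGraph W) v k x := by
  rcases lt_trichotomy (v k) 0 with hk | hk | hk
  · obtain ⟨p, hp⟩ := F.exists_pos
    exact Or.inr ⟨p, isFiedlerSide_neg
      (F.neg.isFiedlerSide_of_pos (by simpa) (by simpa using hk.trans hp))⟩
  · have hneg : ∀ x y, v x < 0 → ((networkGraph W).deleteIncidenceSet k).Reachable x y →
        ¬ v y < 0 → ∃ x, IsFiedlerSide (networkGraph W) v k x := by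
      intro x y hx hxy hy
      obtain ⟨p, hp, hpx⟩ := F.exists_pos_of_neg hk hx hxy hy
      exact ⟨p, F.isFiedlerSide_of_zero hk hp hx hpx⟩
    have hpos : ∀ x y, 0 < v x → ((networkGraph W).deleteIncidenceSet k).Reachable x y →
        ¬ 0 < v y → ∃ x, IsFiedlerSide (networkGraph W) v k x := by
      intro x y hx hxy hy
      obtain ⟨n, hn, hnx⟩ := F.neg.exists_pos_of_neg (k := k) (x := x) (y := y) (by simp [hk])
        (by simpa) hxy (by simpa using hy)
      exact ⟨x, F.isFiedlerSide_of_zero hk hx (by simpa using hn) hnx.symm⟩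
    by_cases hc : IsCharacteristicNode (networkGraph W) v k
    · exact Or.inl hc
    right
    simp only [IsCharacteristicNode, hk, true_and, not_forall] at hc
    obtain ⟨x, y, -, hxy, hne⟩ := hc
    rcases lt_trichotomy (v x) 0 with hx | hx | hx
    · refine hneg x y hx hxy fun hy => hne ?_
      rw [sign_neg hx, sign_neg hy]
    · rcases lt_trichotomy (v y) 0 with hy | hy | hy
      · exact hneg y x hy hxy.symm hx.not_lt
      · exact absurd (by rw [hx, hy]) hne
      · exact hpos y x hy hxy.symm hx.not_gt
    · refine hpos x y hx hxy fun hy => hne ?_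
      rw [sign_pos hx, sign_pos hy]
  · obtain ⟨n, hn⟩ := F.exists_neg
    exact Or.inr ⟨n, F.isFiedlerSide_of_pos hk (hn.trans hk)⟩

/-! ### Core blocks and characteristic nodes -/

theorem IsFiedlerPair.isFiedlerSide_of_isCoreBlock (F : IsFiedlerPair W v μ)
    {B : (networkGraph W).Subgraph} (hB : IsCoreBlock (networkGraph W) v B) {k b : V}
    (hk : k ∈ B.verts) (hb : b ∈ B.verts) (hbk : b ≠ k) :
    IsFiedlerSide (networkGraph W) v k b := by
  obtain ⟨hB, ⟨p, hp, hvp⟩, n, hn, hvn⟩ := hB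
  rcases lt_trichotomy (v k) 0 with hk0 | hk0 | hk0
  · have hpk : p ≠ k := by rintro rfl; linarith
    exact (isFiedlerSide_neg (F.neg.isFiedlerSide_of_pos (by simpa)
      (by simpa using hk0.trans hvp))).congr (hB.reachable_deleteIncidenceSet hp hb hpk hbk)
  · have hpk : p ≠ k := by rintro rfl; linarith
    have hnk : n ≠ k := by rintro rfl; linarith
    exact (F.isFiedlerSide_of_zero hk0 hvp hvn
      (hB.reachable_deleteIncidenceSet hp hn hpk hnk)).congr
      (hB.reachable_deleteIncidenceSet hp hb hpk hbk)
  · have hnk : n ≠ k := by rintro rfl; linarith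
    exact (F.isFiedlerSide_of_pos hk0 (hvn.trans hk0)).congr
      (hB.reachable_deleteIncidenceSet hn hb hnk hbk)

theorem IsFiedlerPair.nontrivial (F : IsFiedlerPair W v μ) : Nontrivial V := by
  obtain ⟨p, hp⟩ := F.exists_pos
  obtain ⟨n, hn⟩ := F.exists_neg
  exact ⟨p, n, fun h => by rw [h] at hp; linarith⟩

/-- A block on which the distinguished sides of all nodes point to each other controls the signs
outside of it, and must therefore have both signs itself. -/
theorem IsFiedlerPair.isCoreBlock_of_isFiedlerSide (F : IsFiedlerPair W v μ)
    {B : (networkGraph W).Subgraph} (hB : IsBlock (networkGraph W) B)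
    (hside : ∀ k ∈ B.verts, ∀ b ∈ B.verts, b ≠ k → IsFiedlerSide (networkGraph W) v k b) :
    IsCoreBlock (networkGraph W) v B := by
  have := F.nontrivial
  have hout : ∀ y, y ∉ B.verts → ∃ k ∈ B.verts,
      (0 < v k → v k ≤ v y) ∧ (v k < 0 → v y ≤ v k) ∧ (v k = 0 → v y = 0) := by
    intro y hy
    obtain ⟨k, hk, hsep⟩ := hB.exists_attachment F.conn hy
    obtain ⟨b, hb, hbk⟩ := hB.exists_ne F.conn k
    exact ⟨k, hk, (hside k hk b hb hbk).2 y (fun h => hy (h ▸ hk)) (hsep b hb hbk)⟩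
  refine ⟨hB, ?_, ?_⟩
  · obtain ⟨p, hp⟩ := F.exists_pos
    by_cases hpB : p ∈ B.verts
    · exact ⟨p, hpB, hp⟩
    obtain ⟨k, hk, -, h2, h3⟩ := hout p hpB
    refine ⟨k, hk, ?_⟩
    by_contra hle
    rcases (not_lt.1 hle).lt_or_eq with h | h
    · linarith [h2 h]
    · linarith [h3 h]
  · obtain ⟨n, hn⟩ := F.exists_neg
    by_cases hnB : n ∈ B.verts
    · exact ⟨n, hnB, hn⟩
    obtain ⟨k, hk, h1, -, h3⟩ := hout n hnB
    refine ⟨k, hk, ?_⟩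
    by_contra hle
    rcases (not_lt.1 hle).lt_or_eq with h | h
    · linarith [h1 h]
    · linarith [h3 h.symm]

end

theorem SimpleGraph.Connected.exists_adj_reachable_deleteIncidenceSet {V : Type*}
    {G : SimpleGraph V} (hG : G.Connected) {k x : V} (hx : x ≠ k) :
    ∃ j, G.Adj k j ∧ (G.deleteIncidenceSet k).Reachable x j := by
  obtain ⟨p⟩ := hG.preconnected x k
  induction p with
  | nil => exact absurd rfl hx
  | @cons x x' k hadj _ ih =>
    by_cases hx' : x' = k
    · exact ⟨x, hx' ▸ hadj.symm, SimpleGraph.Reachable.refl x⟩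
    · obtain ⟨j, hj, hr⟩ := ih hx'
      exact ⟨j, hj, (SimpleGraph.Adj.reachable
        (SimpleGraph.deleteIncidenceSet_adj.2 ⟨hadj, hx, hx'⟩)).trans hr⟩

theorem SimpleGraph.Reachable.deleteIncidenceSet_of_not_reachable {V : Type*}
    {G : SimpleGraph V} {k l a z : V} (h : (G.deleteIncidenceSet l).Reachable a z)
    (hk : ¬ (G.deleteIncidenceSet l).Reachable a k) : (G.deleteIncidenceSet k).Reachable a z := by
  rw [SimpleGraph.reachable_iff_reflTransGen] at h
  induction h with
  | refl => exact SimpleGraph.Reachable.refl a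
  | @tail b c hb hbc ih =>
    rw [← SimpleGraph.reachable_iff_reflTransGen] at hb
    refine ih.trans (SimpleGraph.Adj.reachable (SimpleGraph.deleteIncidenceSet_adj.2
      ⟨(SimpleGraph.deleteIncidenceSet_adj.1 hbc).1, ?_, ?_⟩))
    · rintro rfl
      exact hk hb
    · rintro rfl
      exact hk (hb.trans hbc.reachable)

theorem IsCharacteristicNode.not_isCoreBlock {V : Type*} {G : SimpleGraph V} {v : V → ℝ}
    {c : V} (hc : IsCharacteristicNode G v c) (B : G.Subgraph) : ¬ IsCoreBlock G v B := by
  rintro ⟨hB, ⟨p, hp, hvp⟩, n, hn, hvn⟩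
  have hpc : p ≠ c := by rintro rfl; exact hvp.ne' hc.1
  have hnc : n ≠ c := by rintro rfl; exact hvn.ne hc.1
  have := hc.2 p n hpc (hB.reachable_deleteIncidenceSet hp hn hpc hnc)
  rw [sign_pos hvp, sign_neg hvn] at this
  exact absurd this (by decide)

theorem IsCharacteristicNode.eq_of_isCoreNode {V : Type*} {G : SimpleGraph V} {v : V → ℝ}
    {c c' : V} (hc : IsCharacteristicNode G v c) (hc' : IsCoreNode G v c') : c' = c := by
  by_contra hne
  obtain ⟨-, -, h0, j, hj, hvj⟩ := hc'
  have hjc : j ≠ c := by rintro rfl; exact hvj hc.1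
  have := hc.2 c' j hne
    (SimpleGraph.deleteIncidenceSet_adj.2 ⟨hj, hne, hjc⟩ : (G.deleteIncidenceSet c).Adj c' j).reachable
  rw [h0, sign_zero, eq_comm, sign_eq_zero_iff] at this
  exact hvj this

section

variable {V : Type*} [Fintype V] [DecidableEq V] {W : Matrix V V ℝ} {v : V → ℝ} {μ : ℝ}

/-- Follow the distinguished sides until they point to each other: the block sought lies at a node
whose distinguished side is smallest. -/
theorem IsFiedlerPair.exists_isCoreBlock (F : IsFiedlerPair W v μ)
    (hno : ∀ c, ¬ IsCharacteristicNode (networkGraph W) v c) :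
    ∃ B, IsCoreBlock (networkGraph W) v B := by
  have hex : ∀ k, ∃ x, IsFiedlerSide (networkGraph W) v k x := fun k =>
    (F.isCharacteristicNode_or k).resolve_left (hno k)
  choose x hx using hex
  let T : V → Set V := fun k => {z | ((networkGraph W).deleteIncidenceSet k).Reachable (x k) z}
  have : Nonempty V := F.conn.nonempty
  obtain ⟨k, hkmin⟩ := Finite.exists_min fun k => (T k).ncard
  obtain ⟨j, hkj, hxj⟩ := F.conn.exists_adj_reachable_deleteIncidenceSet (hx k).1
  obtain ⟨B, hB, hkB, hjB⟩ := exists_isBlock_of_adj hkj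
  refine ⟨B, F.isCoreBlock_of_isFiedlerSide hB fun l hl b hb hbl => ?_⟩
  by_cases hlk : l = k
  · subst hlk
    exact (hx l).congr (hxj.trans (hB.reachable_deleteIncidenceSet hjB hb hkj.ne' hbl))
  by_cases hr : ((networkGraph W).deleteIncidenceSet l).Reachable (x l) k
  · exact (hx l).congr
      (hr.trans (hB.reachable_deleteIncidenceSet hkB hb (Ne.symm hlk) hbl))
  exfalso
  -- otherwise the distinguished side of `l` is part of that of `k`, and misses `l`
  obtain ⟨m, hlm, hxm⟩ := F.conn.exists_adj_reachable_deleteIncidenceSet (hx l).1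
  have hlT : l ∈ T k := hxj.trans (hB.reachable_deleteIncidenceSet hjB hl hkj.ne' hlk)
  have hmk : m ≠ k := fun h => hr (h ▸ hxm)
  have hsub : T l ⊆ T k := by
    intro z hz
    have hmz : ((networkGraph W).deleteIncidenceSet k).Reachable m z :=
      SimpleGraph.Reachable.deleteIncidenceSet_of_not_reachable (hxm.symm.trans hz)
        fun h => hr (hxm.trans h)
    exact SimpleGraph.Reachable.trans hlT ((SimpleGraph.Adj.reachable
      (SimpleGraph.deleteIncidenceSet_adj.2 ⟨hlm, hlk, hmk⟩)).trans hmz)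
  have hlt : (T l).ncard < (T k).ncard := Set.ncard_lt_ncard
    ⟨hsub, fun h => SimpleGraph.Reachable.ne_of_deleteIncidenceSet (h hlT) (hx l).1 rfl⟩
    (Set.toFinite _)
  exact absurd (hkmin l) (not_le.2 hlt)

theorem IsFiedlerPair.isCoreNode_of_isCharacteristicNode (F : IsFiedlerPair W v μ) {c : V}
    (hc : IsCharacteristicNode (networkGraph W) v c) : IsCoreNode (networkGraph W) v c := by
  obtain ⟨p, hp⟩ := F.exists_pos
  obtain ⟨n, hn⟩ := F.exists_neg
  have hpc : p ≠ c := by rintro rfl; exact hp.ne' hc.1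
  have hnc : n ≠ c := by rintro rfl; exact hn.ne hc.1
  refine ⟨hc.not_isCoreBlock, ⟨trivial, fun h => ?_⟩, hc.1, ?_⟩
  · have := hc.2 p n hpc (h.reachable_deleteIncidenceSet trivial trivial hpc hnc)
    rw [sign_pos hp, sign_neg hn] at this
    exact absurd this (by decide)
  · obtain ⟨j, hj, hpj⟩ := F.conn.exists_adj_reachable_deleteIncidenceSet hpc
    refine ⟨j, hj, ?_⟩
    have := hc.2 p j hpc hpj
    rw [sign_pos hp] at this
    exact (sign_eq_one_iff.1 this.symm).ne'

/-- Beside a core block, all blocks have constant sign. -/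
theorem IsFiedlerPair.block_sign_of_isCoreBlock (F : IsFiedlerPair W v μ)
    {B₀ B : (networkGraph W).Subgraph} (hB₀ : IsCoreBlock (networkGraph W) v B₀)
    (hB : IsBlock (networkGraph W) B) (hne : B ≠ B₀) :
    (∀ i ∈ B.verts, 0 < v i) ∨ (∀ i ∈ B.verts, v i < 0) ∨ ∀ i ∈ B.verts, v i = 0 := by
  have := F.nontrivial
  obtain ⟨y, hyB, hyB₀⟩ : ∃ y ∈ B.verts, y ∉ B₀.verts := by
    by_contra! h
    obtain ⟨a, ha⟩ := hB.connected.nonempty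
    obtain ⟨b, hb, hba⟩ := hB.exists_ne F.conn a
    exact hne (hB.eq_of_mem_of_mem hB₀.1 hba hb ha (h b hb) (h a ha))
  obtain ⟨k, hk, hsep⟩ := hB₀.1.exists_attachment F.conn hyB₀
  obtain ⟨b, hb, hbk⟩ := hB₀.1.exists_ne F.conn k
  have hyk : y ≠ k := fun h => hyB₀ (h ▸ hk)
  have hall : ∀ z ∈ B.verts, z ≠ k →
      (0 < v k → v k ≤ v z) ∧ (v k < 0 → v z ≤ v k) ∧ (v k = 0 → v z = 0) := by
    intro z hz hzk
    refine (F.isFiedlerSide_of_isCoreBlock hB₀ hk hb hbk).2 z hzk fun h => hsep b hb hbk ?_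
    exact h.trans (hB.reachable_deleteIncidenceSet hz hyB hzk hyk)
  rcases lt_trichotomy (v k) 0 with h0 | h0 | h0
  · refine Or.inr (Or.inl fun z hz => ?_)
    by_cases hzk : z = k
    · rwa [hzk]
    · exact ((hall z hz hzk).2.1 h0).trans_lt h0
  · refine Or.inr (Or.inr fun z hz => ?_)
    by_cases hzk : z = k
    · rwa [hzk]
    · exact (hall z hz hzk).2.2 h0
  · refine Or.inl fun z hz => ?_
    by_cases hzk : z = k
    · rwa [hzk]
    · exact h0.trans_le ((hall z hz hzk).1 h0)

theorem IsFiedlerPair.eq_of_isCoreBlock (F : IsFiedlerPair W v μ)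
    {B₀ B : (networkGraph W).Subgraph} (hB₀ : IsCoreBlock (networkGraph W) v B₀)
    (hB : IsCoreBlock (networkGraph W) v B) : B = B₀ := by
  by_contra hne
  obtain ⟨hB, ⟨p, hp, hvp⟩, n, hn, hvn⟩ := hB
  rcases F.block_sign_of_isCoreBlock hB₀ hB hne with h | h | h
  · linarith [h n hn]
  · linarith [h p hp]
  · linarith [h p hp]

/-- The entries of a Fiedler vector move away from zero on leaving the core block. -/
theorem IsFiedlerPair.core_le_of_mem (F : IsFiedlerPair W v μ)
    {B₀ B : (networkGraph W).Subgraph} (hB₀ : IsCoreBlock (networkGraph W) v B₀)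
    (hB : IsBlock (networkGraph W) B) (hne : B ≠ B₀) {i j : V} (hi₀ : i ∈ B₀.verts)
    (hi : i ∈ B.verts) (hj : j ∈ B.verts) (hij : j ≠ i) :
    (0 < v i → v i ≤ v j) ∧ (v i < 0 → v j ≤ v i) := by
  have := F.nontrivial
  have hj₀ : j ∉ B₀.verts := fun h => hne (hB.eq_of_mem_of_mem hB₀.1 hij hj hi h hi₀)
  obtain ⟨k, hk, hsep⟩ := hB₀.1.exists_attachment F.conn hj₀
  have hki : k = i := by
    by_contra h
    exact hsep i hi₀ (Ne.symm h) (hB.reachable_deleteIncidenceSet hi hj (Ne.symm h)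
      fun h => hj₀ (h ▸ hk))
  subst hki
  obtain ⟨b, hb, hbk⟩ := hB₀.1.exists_ne F.conn k
  have h := (F.isFiedlerSide_of_isCoreBlock hB₀ hk hb hbk).2 j hij (hsep b hb hbk)
  exact ⟨h.1, h.2.1⟩

theorem IsFiedlerPair.block_sign_of_isCharacteristicNode (F : IsFiedlerPair W v μ) {c : V}
    (hc : IsCharacteristicNode (networkGraph W) v c) {B : (networkGraph W).Subgraph}
    (hB : IsBlock (networkGraph W) B) :
    (∀ i ∈ B.verts, i ≠ c → 0 < v i) ∨ (∀ i ∈ B.verts, i ≠ c → v i < 0) ∨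
      ∀ i ∈ B.verts, v i = 0 := by
  have := F.nontrivial
  obtain ⟨y, hy, hyc⟩ := hB.exists_ne F.conn c
  have hall : ∀ z ∈ B.verts, z ≠ c → SignType.sign (v y) = SignType.sign (v z) :=
    fun z hz hzc => hc.2 y z hyc (hB.reachable_deleteIncidenceSet hy hz hyc hzc)
  rcases lt_trichotomy (v y) 0 with h0 | h0 | h0
  · refine Or.inr (Or.inl fun z hz hzc => ?_)
    have := hall z hz hzc
    rw [sign_neg h0] at this
    exact sign_eq_neg_one_iff.1 this.symm
  · refine Or.inr (Or.inr fun z hz => ?_)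
    by_cases hzc : z = c
    · rw [hzc, hc.1]
    have := hall z hz hzc
    rw [h0, sign_zero] at this
    exact sign_eq_zero_iff.1 this.symm
  · refine Or.inl fun z hz hzc => ?_
    have := hall z hz hzc
    rw [sign_pos h0] at this
    exact sign_eq_one_iff.1 this.symm

end

/-! ### The FSN network -/

theorem not_ratioKept_of_eq_zero {V : Type*} {v : V → ℝ} {i j : V} (hi : v i = 0) :
    ¬ RatioKept v i j := by
  rintro (⟨-, h | h⟩ | ⟨-, h⟩)
  · rw [hi, zero_div] at h
    linarith
  · rw [hi, zero_div] at h
    linarith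
  · exact h hi

theorem not_ratioKept_of_pos_of_le {V : Type*} {v : V → ℝ} {i j : V} (hi : 0 < v i)
    (hij : v i ≤ v j) : ¬ RatioKept v i j := by
  have hj : 0 < v j := hi.trans_le hij
  rintro (⟨-, h | h⟩ | ⟨h, -⟩)
  · exact absurd h (not_lt.2 ((div_le_one hj).2 hij))
  · exact absurd h (not_lt.2 (div_nonneg hi.le hj.le))
  · exact hj.ne' h

theorem ratioKept_neg_iff {V : Type*} {v : V → ℝ} {i j : V} :
    RatioKept (-v) i j ↔ RatioKept v i j := by
  simp [RatioKept, neg_div_neg_eq]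

theorem ratioKept_of_lt {V : Type*} {v : V → ℝ} {i j : V} (hi : 0 < v i) (hji : v j < v i) :
    RatioKept v i j := by
  rcases lt_trichotomy (v j) 0 with hj | hj | hj
  · exact Or.inl ⟨hj.ne, Or.inr (div_neg_of_pos_of_neg hi hj)⟩
  · exact Or.inr ⟨hj, hi.ne'⟩
  · exact Or.inl ⟨hj.ne', Or.inl ((one_lt_div hj).2 hji)⟩

/-- Between nodes of equal (weak) sign, a kept arc leads towards zero. -/
theorem RatioKept.abs_lt_abs {V : Type*} {v : V → ℝ} {i j : V} (h : RatioKept v i j)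
    (hsign : 0 ≤ v i * v j) : |v j| < |v i| := by
  rcases h with ⟨hj, h | h⟩ | ⟨hj, hi⟩
  · have h1 : 1 < |v i| / |v j| := by
      rw [← abs_div]
      exact h.trans_le (le_abs_self _)
    rwa [one_lt_div (abs_pos.2 hj)] at h1
  · have h1 : v i * v j = v i / v j * (v j) ^ 2 := by field_simp
    have h2 : 0 < (v j) ^ 2 := by positivity
    nlinarith
  · rw [hj, abs_zero]
    exact abs_pos.2 hi

theorem mul_nonneg_of_signed_block {V : Type*} {G : SimpleGraph V} {v : V → ℝ} {B : G.Subgraph}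
    (hB : IsPositiveBlock G v B ∨ IsNegativeBlock G v B) {i j : V} (hi : i ∈ B.verts)
    (hj : j ∈ B.verts) : 0 ≤ v i * v j := by
  rcases hB with hB | hB
  · have h : ∀ k ∈ B.verts, 0 ≤ v k := fun k hk => by
      rcases hB.2 k hk with h | h
      · exact h.le
      · exact h.2.2.1.ge
    exact mul_nonneg (h i hi) (h j hj)
  · have h : ∀ k ∈ B.verts, v k ≤ 0 := fun k hk => by
      rcases hB.2 k hk with h | h
      · exact h.le
      · exact h.2.2.1.le
    exact mul_nonneg_of_nonpos_of_nonpos (h i hi) (h j hj)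

/-- `i` and `j` lie in a common positive or negative block. -/
def ShareSignedBlock {V : Type*} (G : SimpleGraph V) (v : V → ℝ) (i j : V) : Prop :=
  ∃ B : G.Subgraph, (IsPositiveBlock G v B ∨ IsNegativeBlock G v B) ∧ i ∈ B.verts ∧ j ∈ B.verts

theorem ShareSignedBlock.symm {V : Type*} {G : SimpleGraph V} {v : V → ℝ} {i j : V}
    (h : ShareSignedBlock G v i j) : ShareSignedBlock G v j i := by
  obtain ⟨B, hB, hi, hj⟩ := h
  exact ⟨B, hB, hj, hi⟩

theorem fsnWeights_of_ratioKept {V : Type*} {W : Matrix V V ℝ} {v : V → ℝ} {i j : V}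
    (h : RatioKept v i j) : fsnWeights W v i j = W i j := by
  simp [fsnWeights, h]

theorem fsnWeights_of_not_shareSignedBlock {V : Type*} {W : Matrix V V ℝ} {v : V → ℝ} {i j : V}
    (h : ¬ ShareSignedBlock (networkGraph W) v i j) : fsnWeights W v i j = W i j := by
  simp only [fsnWeights, Matrix.of_apply]
  exact if_neg h

theorem fsnWeights_of_not_ratioKept {V : Type*} {W : Matrix V V ℝ} {v : V → ℝ} {i j : V}
    (h : ShareSignedBlock (networkGraph W) v i j) (hr : ¬ RatioKept v i j) :
    fsnWeights W v i j = 0 := by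
  simp only [fsnWeights, Matrix.of_apply]
  exact (if_pos h).trans (if_neg hr)

theorem fsnWeights_eq_or {V : Type*} (W : Matrix V V ℝ) (v : V → ℝ) (i j : V) :
    fsnWeights W v i j = W i j ∨ fsnWeights W v i j = 0 := by
  by_cases h : ShareSignedBlock (networkGraph W) v i j
  · by_cases hr : RatioKept v i j
    · exact Or.inl (fsnWeights_of_ratioKept hr)
    · exact Or.inr (fsnWeights_of_not_ratioKept h hr)
  · exact Or.inl (fsnWeights_of_not_shareSignedBlock h)

theorem agentAverage_eq {V : Type*} [Fintype V] {d : ℕ} {S : Set V} {T : Finset V}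
    (hT : ∀ i, i ∈ T ↔ i ∈ S) (f : V → EuclideanSpace ℝ (Fin d)) :
    agentAverage S f = (T.card : ℝ)⁻¹ • ∑ i ∈ T, f i := by
  classical
  have : T = S.toFinset := by
    ext i
    simp [hT]
  rw [this, agentAverage]

section

variable {V : Type*} [Fintype V] [DecidableEq V] {W : Matrix V V ℝ} {v : V → ℝ} {μ : ℝ}

theorem IsFiedlerPair.exists_ratioKept (F : IsFiedlerPair W v μ) {i : V} (hi : v i ≠ 0) :
    ∃ j, W i j ≠ 0 ∧ RatioKept v i j := by
  have hpos : ∀ u : V → ℝ, IsFiedlerPair W u μ → 0 < u i → ∃ j, W i j ≠ 0 ∧ RatioKept u i j := by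
    intro u Fu hu
    have h := Fu.sum_mul_sub i
    have h1 : 0 < μ * u i := mul_pos F.pos hu
    rw [← h] at h1
    obtain ⟨j, -, hj⟩ := Finset.exists_lt_of_sum_lt
      (f := fun _ : V => (0 : ℝ)) (by simpa using h1)
    have hW : W i j ≠ 0 := fun h0 => by simp [h0] at hj
    refine ⟨j, hW, ratioKept_of_lt hu ?_⟩
    exact sub_pos.1 (pos_of_mul_pos_right hj (F.nonneg i j))
  rcases lt_or_gt_of_ne hi with h | h
  · obtain ⟨j, hj, hr⟩ := hpos (-v) F.neg (by simpa using h)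
    exact ⟨j, hj, ratioKept_neg_iff.1 hr⟩
  · exact hpos v F h

/-- Let `S` be a set of nodes that contains every block which is not positive or negative, and all
zero nodes. If in positive and negative blocks the nodes of `S` follow nobody, and `S` is connected
in the FSN network, then `S` is a closed undirected root of that network: all other nodes follow
only nodes nearer to zero. -/
theorem IsFiedlerPair.hasConsensusValue_of_root (F : IsFiedlerPair W v μ) {S : Set V}
    (hblock : ∀ B, IsBlock (networkGraph W) B →
      (IsPositiveBlock (networkGraph W) v B ∨ IsNegativeBlock (networkGraph W) v B) ∨ B.verts ⊆ S)
    (hzero : ∀ i, v i = 0 → i ∈ S)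
    (hroot : ∀ i ∈ S, ∀ j, j ≠ i → ShareSignedBlock (networkGraph W) v i j → ¬ RatioKept v i j)
    {r : V} (hr : r ∈ S)
    (hconn : ∀ i ∈ S,
      Relation.ReflTransGen (fun a b => a ∈ S ∧ b ∈ S ∧ fsnWeights W v a b ≠ 0) r i)
    {d : ℕ} {x : ℝ → V → EuclideanSpace ℝ (Fin d)}
    (hx : IsConsensusTrajectory (fsnWeights W v) x) :
    HasConsensusValue x (agentAverage S (x 0)) := by
  classical
  have hmem : ∀ i, i ∈ S.toFinset ↔ i ∈ S := fun i => Set.mem_toFinset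
  have hdiag : ∀ i, fsnWeights W v i i = 0 := by
    intro i
    rcases fsnWeights_eq_or W v i i with h | h
    · rw [h, F.diag]
    · exact h
  have hnonneg : ∀ i j, 0 ≤ fsnWeights W v i j := by
    intro i j
    rcases fsnWeights_eq_or W v i j with h | h
    · rw [h]
      exact F.nonneg i j
    · exact h.ge
  have hW : ∀ i j, fsnWeights W v i j ≠ 0 → W i j ≠ 0 := by
    intro i j h h0
    rcases fsnWeights_eq_or W v i j with h1 | h1
    · exact h (h1.trans h0)
    · exact h h1
  -- an edge with an end outside `S` lies in a positive or negative block
  have hshare : ∀ i j, i ∉ S → W i j ≠ 0 → ShareSignedBlock (networkGraph W) v i j := by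
    intro i j hi hij
    obtain ⟨B, hB, hiB, hjB⟩ := exists_isBlock_of_adj (F.adj.2 hij)
    exact ⟨B, (hblock B hB).resolve_right fun h => hi (h hiB), hiB, hjB⟩
  have hrow : ∀ i ∈ S, ∀ j, ShareSignedBlock (networkGraph W) v i j → fsnWeights W v i j = 0 := by
    intro i hi j hij
    by_cases hji : j = i
    · rw [hji, hdiag]
    · exact fsnWeights_of_not_ratioKept hij (hroot i hi j hji hij)
  have hsymm : ∀ i ∈ S, ∀ j ∈ S, fsnWeights W v i j = fsnWeights W v j i := by
    intro i hi j hj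
    by_cases h : ShareSignedBlock (networkGraph W) v i j
    · rw [hrow i hi j h, hrow j hj i h.symm]
    · rw [fsnWeights_of_not_shareSignedBlock h,
        fsnWeights_of_not_shareSignedBlock fun h' => h h'.symm, F.symm.apply]
  have hsymmRel : Std.Symm fun a b => a ∈ S ∧ b ∈ S ∧ fsnWeights W v a b ≠ 0 :=
    ⟨fun a b h => ⟨h.2.1, h.1, by rw [hsymm b h.2.1 a h.1]; exact h.2.2⟩⟩
  intro i
  rw [agentAverage_eq hmem]
  refine tendsto_average_of_root (U := fsnWeights W v) ⟨r, (hmem r).2 hr⟩ hnonneg ?_ ?_ ?_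
    (fun i => |v i|) ?_ ?_ ?_ i
  · intro i hi j hj
    by_contra h
    rw [hmem] at hi hj
    exact h (hrow i hi j (hshare j i hj (by rw [F.symm.apply]; exact hW i j h)).symm)
  · exact fun i hi j hj => hsymm i ((hmem i).1 hi) j ((hmem j).1 hj)
  · intro i hi j hj
    simp only [hmem] at hi hj ⊢
    exact (Relation.ReflTransGen.stdSymm.symm _ _ (hconn i hi)).trans (hconn j hj)
  · intro i hi
    rw [hmem] at hi
    obtain ⟨j, hij, hr⟩ := F.exists_ratioKept fun h => hi (hzero i h)
    exact ⟨j, by rwa [fsnWeights_of_ratioKept hr]⟩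
  · intro i hi j hij
    rw [hmem] at hi
    have hsh := hshare i j hi (hW i j hij)
    have hr : RatioKept v i j := by
      by_contra hr
      exact hij (fsnWeights_of_not_ratioKept hsh hr)
    obtain ⟨B, hB, hiB, hjB⟩ := hsh
    exact hr.abs_lt_abs (mul_nonneg_of_signed_block hB hiB hjB)
  · intro i t ht
    exact (hx i t ht).congr_deriv (by rw [networkLaplacian_smul_sum hdiag])

/-- Zero nodes hanging on a zero node `k` are joined to it through zero nodes. -/
theorem IsFiedlerPair.reflTransGen_of_zero_component (F : IsFiedlerPair W v μ) {R : V → V → Prop}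
    (hR : ∀ a b, (networkGraph W).Adj a b → v a = 0 → v b = 0 → R a b) {k i : V} (hk : v k = 0)
    (hik : i ≠ k)
    (hcomp : ∀ z, ((networkGraph W).deleteIncidenceSet k).Reachable i z → v z = 0) :
    Relation.ReflTransGen R k i := by
  obtain ⟨j, hkj, hij⟩ := F.conn.exists_adj_reachable_deleteIncidenceSet hik
  have h : ∀ z, ((networkGraph W).deleteIncidenceSet k).Reachable j z →
      Relation.ReflTransGen R k z := by
    intro z hz
    rw [SimpleGraph.reachable_iff_reflTransGen] at hz
    induction hz with
    | refl => exact Relation.ReflTransGen.single (hR k j hkj hk (hcomp j hij))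
    | @tail b c hb hbc ih =>
      rw [← SimpleGraph.reachable_iff_reflTransGen] at hb
      exact ih.tail (hR b c (SimpleGraph.deleteIncidenceSet_adj.1 hbc).1 (hcomp b (hij.trans hb))
        (hcomp c ((hij.trans hb).trans hbc.reachable)))
  exact h i hij.symm

theorem IsFiedlerPair.hasConsensusValue_of_isCoreBlock (F : IsFiedlerPair W v μ)
    {B₀ : (networkGraph W).Subgraph} (hB₀ : IsCoreBlock (networkGraph W) v B₀) {d : ℕ}
    {x : ℝ → V → EuclideanSpace ℝ (Fin d)} (hx : IsConsensusTrajectory (fsnWeights W v) x) :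
    HasConsensusValue x (agentAverage (B₀.verts ∪ zeroBlockAgents (networkGraph W) v) (x 0)) := by
  have := F.nontrivial
  set S := B₀.verts ∪ zeroBlockAgents (networkGraph W) v
  have hnocore : ∀ c, ¬ IsCoreNode (networkGraph W) v c := fun c hc => hc.1 B₀ hB₀
  have hposB : ∀ B, IsPositiveBlock (networkGraph W) v B → ∀ i ∈ B.verts, 0 < v i :=
    fun B hB i hi => (hB.2 i hi).resolve_right (hnocore i)
  have hnegB : ∀ B, IsNegativeBlock (networkGraph W) v B → ∀ i ∈ B.verts, v i < 0 :=
    fun B hB i hi => (hB.2 i hi).resolve_right (hnocore i)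
  have hblock : ∀ B, IsBlock (networkGraph W) B →
      (IsPositiveBlock (networkGraph W) v B ∨ IsNegativeBlock (networkGraph W) v B) ∨
        B.verts ⊆ S := by
    intro B hB
    by_cases hne : B = B₀
    · exact Or.inr (hne ▸ Set.subset_union_left)
    rcases F.block_sign_of_isCoreBlock hB₀ hB hne with h | h | h
    · exact Or.inl (Or.inl ⟨hB, fun i hi => Or.inl (h i hi)⟩)
    · exact Or.inl (Or.inr ⟨hB, fun i hi => Or.inl (h i hi)⟩)
    · exact Or.inr fun i hi => Or.inr ⟨B, ⟨hB, h⟩, hi⟩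
  have hnz : ∀ i j, ShareSignedBlock (networkGraph W) v i j → v i ≠ 0 := by
    rintro i j ⟨B, hB | hB, hi, -⟩
    · exact (hposB B hB i hi).ne'
    · exact (hnegB B hB i hi).ne
  have hne₀ : ∀ B, IsPositiveBlock (networkGraph W) v B ∨ IsNegativeBlock (networkGraph W) v B →
      IsBlock (networkGraph W) B ∧ B ≠ B₀ := by
    obtain ⟨-, ⟨p, hp, hvp⟩, n, hn, hvn⟩ := hB₀
    rintro B (hB | hB)
    · refine ⟨hB.1, ?_⟩
      rintro rfl
      linarith [hposB B hB n hn]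
    · refine ⟨hB.1, ?_⟩
      rintro rfl
      linarith [hnegB B hB p hp]
  have hzero : ∀ i, v i = 0 → i ∈ S := by
    intro i hi
    obtain ⟨j, hij⟩ := F.conn.preconnected.exists_adj_of_nontrivial i
    obtain ⟨B, hB, hiB, hjB⟩ := exists_isBlock_of_adj hij
    exact ((hblock B hB).resolve_left fun h => hnz i j ⟨B, h, hiB, hjB⟩ hi) hiB
  obtain ⟨r, hr⟩ := hB₀.1.connected.nonempty
  -- the core block is connected in the FSN network, as it shares no edge with another block
  have hcore : ∀ i ∈ B₀.verts,
      Relation.ReflTransGen (fun a b => a ∈ S ∧ b ∈ S ∧ fsnWeights W v a b ≠ 0) r i := by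
    intro i hi
    have h := hB₀.1.connected.preconnected ⟨r, hr⟩ ⟨i, hi⟩
    rw [SimpleGraph.reachable_iff_reflTransGen] at h
    refine Relation.ReflTransGen.lift (p := fun a b => a ∈ S ∧ b ∈ S ∧ fsnWeights W v a b ≠ 0)
      Subtype.val (fun a b hab => ?_) _ _ h
    have hadj : (networkGraph W).Adj a b := B₀.coe_adj_sub a b hab
    refine ⟨Or.inl a.2, Or.inl b.2, ?_⟩
    rw [fsnWeights_of_not_shareSignedBlock]
    · exact F.adj.1 hadj
    · rintro ⟨B, hB, ha, hb⟩
      obtain ⟨hB, hne⟩ := hne₀ B hB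
      exact hne (hB.eq_of_mem_of_mem hB₀.1 hadj.ne ha hb a.2 b.2)
  refine F.hasConsensusValue_of_root hblock hzero ?_ (Or.inl hr) ?_ hx
  · rintro i hi j hji hij
    have hi0 := hnz i j hij
    obtain ⟨B, hB, hiB, hjB⟩ := hij
    obtain ⟨hBb, hne⟩ := hne₀ B hB
    have hiB₀ : i ∈ B₀.verts := by
      rcases hi with hi | ⟨Z, hZ, hiZ⟩
      · exact hi
      · exact absurd (hZ.2 i hiZ) hi0
    have h := F.core_le_of_mem hB₀ hBb hne hiB₀ hiB hjB hji
    rcases lt_or_gt_of_ne hi0 with h0 | h0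
    · rw [← ratioKept_neg_iff]
      exact not_ratioKept_of_pos_of_le (by simpa) (by simpa using h.2 h0)
    · exact not_ratioKept_of_pos_of_le h0 (h.1 h0)
  · intro i hi
    by_cases hiB₀ : i ∈ B₀.verts
    · exact hcore i hiB₀
    obtain ⟨Z, hZ, hiZ⟩ := hi.resolve_left hiB₀
    have hi0 := hZ.2 i hiZ
    obtain ⟨k, hk, hsep⟩ := hB₀.1.exists_attachment F.conn hiB₀
    obtain ⟨b, hb, hbk⟩ := hB₀.1.exists_ne F.conn k
    have hik : i ≠ k := fun h => hiB₀ (h ▸ hk)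
    have hside := (F.isFiedlerSide_of_isCoreBlock hB₀ hk hb hbk).2
    have hk0 : v k = 0 := by
      have h := hside i hik (hsep b hb hbk)
      rcases lt_trichotomy (v k) 0 with h0 | h0 | h0
      · linarith [h.2.1 h0]
      · exact h0
      · linarith [h.1 h0]
    refine (hcore k hk).trans (F.reflTransGen_of_zero_component ?_ hk0 hik ?_)
    · intro a b hab ha hb
      refine ⟨hzero a ha, hzero b hb, ?_⟩
      rw [fsnWeights_of_not_shareSignedBlock fun h => hnz a b h ha]
      exact F.adj.1 hab
    · intro z hz
      exact (hside z (hz.ne_of_deleteIncidenceSet hik)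
        fun h => hsep b hb hbk (h.trans hz.symm)).2.2 hk0

theorem IsFiedlerPair.hasConsensusValue_of_isCharacteristicNode (F : IsFiedlerPair W v μ) {c : V}
    (hc : IsCharacteristicNode (networkGraph W) v c) {d : ℕ}
    {x : ℝ → V → EuclideanSpace ℝ (Fin d)} (hx : IsConsensusTrajectory (fsnWeights W v) x) :
    HasConsensusValue x (agentAverage ({c} ∪ zeroBlockAgents (networkGraph W) v) (x 0)) := by
  have := F.nontrivial
  set S := {c} ∪ zeroBlockAgents (networkGraph W) v
  have hcc := F.isCoreNode_of_isCharacteristicNode hc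
  have hblock : ∀ B, IsBlock (networkGraph W) B →
      (IsPositiveBlock (networkGraph W) v B ∨ IsNegativeBlock (networkGraph W) v B) ∨
        B.verts ⊆ S := by
    intro B hB
    have hor : ∀ i, i ≠ c ∨ IsCoreNode (networkGraph W) v i := fun i => by
      by_cases h : i = c
      · exact Or.inr (h ▸ hcc)
      · exact Or.inl h
    rcases F.block_sign_of_isCharacteristicNode hc hB with h | h | h
    · exact Or.inl (Or.inl ⟨hB, fun i hi => (hor i).imp_left (h i hi)⟩)
    · exact Or.inl (Or.inr ⟨hB, fun i hi => (hor i).imp_left (h i hi)⟩)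
    · exact Or.inr fun i hi => Or.inr ⟨B, ⟨hB, h⟩, hi⟩
  have hSzero : ∀ i ∈ S, v i = 0 := by
    rintro i (rfl | ⟨Z, hZ, hiZ⟩)
    · exact hc.1
    · exact hZ.2 i hiZ
  have hnz : ∀ i j, ShareSignedBlock (networkGraph W) v i j → v i = 0 → i = c := by
    rintro i j ⟨B, hB | hB, hi, -⟩ h0
    · exact hc.eq_of_isCoreNode ((hB.2 i hi).resolve_left h0.not_gt)
    · exact hc.eq_of_isCoreNode ((hB.2 i hi).resolve_left h0.not_lt)
  have hzero : ∀ i, v i = 0 → i ∈ S := by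
    intro i hi
    obtain ⟨j, hij⟩ := F.conn.preconnected.exists_adj_of_nontrivial i
    obtain ⟨B, hB, hiB, hjB⟩ := exists_isBlock_of_adj hij
    rcases hblock B hB with h | h
    · exact Or.inl (hnz i j ⟨B, h, hiB, hjB⟩ hi)
    · exact h hiB
  refine F.hasConsensusValue_of_root hblock hzero
    (fun i hi j _ _ => not_ratioKept_of_eq_zero (hSzero i hi)) (r := c) (Or.inl rfl) ?_ hx
  intro i hi
  by_cases hic : i = c
  · rw [hic]
  refine F.reflTransGen_of_zero_component ?_ hc.1 hic ?_
  · intro a b hab ha hb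
    refine ⟨hzero a ha, hzero b hb, ?_⟩
    rw [fsnWeights_of_not_shareSignedBlock]
    · exact F.adj.1 hab
    · exact fun h => hab.ne ((hnz a b h ha).trans (hnz b a h.symm hb).symm)
  · intro z hz
    have h := hc.2 i z hic hz
    rw [hSzero i hi, sign_zero, eq_comm, sign_eq_zero_iff] at h
    exact h

end

theorem HasConsensusValue.achievesConsensus {V : Type*} {d : ℕ}
    {x : ℝ → V → EuclideanSpace ℝ (Fin d)} {a : EuclideanSpace ℝ (Fin d)}
    (h : HasConsensusValue x a) : AchievesConsensus x := by
  intro i j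
  simpa using ((h i).sub (h j)).norm

theorem mainTheorem4 {V : Type*} [Fintype V] [DecidableEq V] (W : Matrix V V ℝ)
    (hsymm : W.IsSymm) (hnonneg : ∀ i j, 0 ≤ W i j) (hdiag : ∀ i, W i i = 0)
    (hconn : (networkGraph W).Connected) (hn : 1 < Fintype.card V)
    (v : V → ℝ) (hv : IsFiedlerVector W hsymm hn v) (d : ℕ) :
    (∀ x : ℝ → V → EuclideanSpace ℝ (Fin d),
      IsConsensusTrajectory (fsnWeights W v) x → AchievesConsensus x) ∧
    (((∃! B, IsCoreBlock (networkGraph W) v B) ∧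
        ∀ B, IsCoreBlock (networkGraph W) v B →
          ∀ x : ℝ → V → EuclideanSpace ℝ (Fin d), IsConsensusTrajectory (fsnWeights W v) x →
            HasConsensusValue x
              (agentAverage (B.verts ∪ zeroBlockAgents (networkGraph W) v) (x 0))) ∨
      ((∃! c, IsCoreNode (networkGraph W) v c) ∧
        ∀ c, IsCoreNode (networkGraph W) v c →
          ∀ x : ℝ → V → EuclideanSpace ℝ (Fin d), IsConsensusTrajectory (fsnWeights W v) x →
            HasConsensusValue x
              (agentAverage ({c} ∪ zeroBlockAgents (networkGraph W) v) (x 0)))) := by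
  have F := hv.isFiedlerPair hnonneg hdiag hconn
  by_cases hc : ∃ c, IsCharacteristicNode (networkGraph W) v c
  · obtain ⟨c, hc⟩ := hc
    refine ⟨fun x hx => (F.hasConsensusValue_of_isCharacteristicNode hc hx).achievesConsensus,
      Or.inr ⟨⟨c, F.isCoreNode_of_isCharacteristicNode hc, fun c' hc' => hc.eq_of_isCoreNode hc'⟩,
        fun c' hc' x hx => ?_⟩⟩
    rw [hc.eq_of_isCoreNode hc']
    exact F.hasConsensusValue_of_isCharacteristicNode hc hx
  · push Not at hc
    obtain ⟨B, hB⟩ := F.exists_isCoreBlock hc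
    exact ⟨fun x hx => (F.hasConsensusValue_of_isCoreBlock hB hx).achievesConsensus,
      Or.inl ⟨⟨B, hB, fun B' hB' => F.eq_of_isCoreBlock hB hB'⟩,
        fun B' hB' x hx => F.hasConsensusValue_of_isCoreBlock hB' hx⟩⟩
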